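/- **Setting.** Formulas of first-order intuitionistic linear logic are built from atoms by $\otimes$, $\&$, $\multimap$, $!$; proofs are sequent calculus proofs (axiom, cut, exchange, left and right rules for $\otimes,\&,\multimap$, dereliction, promotion, contraction, weakening). For a formula $A$ and $n\ge 1$ put $A^n = A\,\&\cdots\&\,A$ ($n$ copies) and ${}_n\mathbf{bool} = A^n\multimap A$; for $0\le i<n$ the boolean $\underline{i}$ is the proof of $\vdash {}_n\mathbf{bool}$ obtained from the $i$-th projection $A^n\vdash A$. Equivalence of proofs means equivalence under cut-elimination. A proof of $!A_1,\dots,!A_r\vdash B$ is *plain* if it is equivalent to one obtained from a proof of $n_1A_1,\dots,n_rA_r\vdash B$ (each $A_i$ repeated $n_i\ge 0$ times) by derelicting all hypotheses and then contracting the $n_i$ copies of $!A_i$ to one (a weakening if $n_i=0$). A proof of $!A_1,\dots,!A_r\vdash\, !B_1\otimes\cdots\otimes !B_t$ is *component-wise plain* if there are plain proofs $\psi_i$ of $!A_1,\dots,!A_r\vdash B_i$ such that it is equivalent to the tensor product of the promotions of the $\psi_i$ followed by contractions. A proof of $!A_1\otimes\cdots\otimes !A_r\vdash\, !B_1\otimes\cdots\otimes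 !B_t$ is component-wise plain if it is equivalent to one obtained by left $\otimes$-rules from a component-wise plain proof of $!A_1,\dots,!A_r\vdash\, !B_1\otimes\cdots\otimes !B_t$. Fix $n,s\ge 1$, states $Q=\{0,\dots,n-1\}$, tape alphabet $\Sigma=\{0,\dots,s-1\}$ with blank symbol $0$, and $\delta:\Sigma\times Q\to\Sigma\times Q\times\{\text{left},\text{right}\}$; write $\delta(i,q)=(\hat\sigma_i^q,\hat q_i^q,\hat d_i^q)$. A Turing machine with transition function $\delta$ and a two-way infinite tape reads the symbol under its head, writes $\hat\sigma$, enters state $\hat q$ and moves its head one square in direction $\hat d$. If the squares at distance more than $h$ from the head are blank, the configuration is encoded relative to the head by the proof $[\sigma_{-h},\dots,\sigma_h;q]_h$ of $\vdash\, !{}_s\mathbf{bool}^{\otimes 2h+1}\otimes !{}_n\mathbf{bool}$, the tensor product of the promotions of $\underline{\sigma_{-h}},\dots,\underline{\sigma_h},\underline{q}$, where $\sigma_p$ is the symbol in position $p$ relative to the head and $q$ is the state. **Proposition.** Let $A$ be a formula. For every $h\ge 0$ there is a proof $${}_h\underline{\mathrm{relstep}}:\ !{}_s\mathbf{bool}^{\otimes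 2h+1}\otimes !{}_n\mathbf{bool}\ \vdash\ !{}_s\mathbf{bool}^{\otimes 2h+3}\otimes !{}_n\mathbf{bool}$$ such that: 1. ${}_h\underline{\mathrm{relstep}}$ is component-wise plain. 2. It encodes one step of the machine in relative coordinates: for every configuration whose squares at distance more than $h$ from the head are blank, the cut of its encoding $[\sigma_{-h},\dots,\sigma_h;q]_h$ against ${}_h\underline{\mathrm{relstep}}$ is equivalent under cut-elimination to the encoding $[\sigma'_{-h-1},\dots,\sigma'_{h+1};q']_{h+1}$, relative to the new head position, of the configuration after one step. 3. Let $k$ be a field, and let $[\![-]\!]$ be the Sweedler semantics over $k$ for any choice of vector spaces for the atoms: $\otimes,\&,\multimap$ are interpreted by tensor product, direct sum and linear maps, $!V$ by the cofree cocommutative coalgebra on $V$, and promotion by lifting to coalgebra morphisms. For $P\in V$ let $|\emptyset\rangle_P\in\, !V$ be the group-like element over $P$. For all scalars $a^m_i$ ($|m|\le h$, $i\in\Sigma$) and $b_q$ ($q\in Q$), with $\alpha^m=\sum_i a^m_i[\![\underline i]\!]$ and $\beta=\sum_q b_q[\![\underline q]\!]$, $$[\![{}_h\underline{\mathrm{relstep}}]\!]\big(|\emptyset\rangle_{\alpha^{-h}}\otimes\cdots\otimes|\emptyset\rangle_{\alpha^h}\otimes|\emptyset\rangle_\beta\big)=|\emptyset\rangle_{\theta^{-h-1}}\otimes\cdots\otimes|\emptyset\rangle_{\theta^{h+1}}\otimes|\emptyset\rangle_\mu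 ,$$ where $$\mu=\sum_{i\in\Sigma}\sum_{q\in Q}a^0_i b_q\,[\![\underline{\hat q_i^q}]\!],\qquad \theta^m=D_{\text{left}}\,w(m+1)\,c(m-1)+D_{\text{right}}\,w(m-1)\,c(m+1)\quad(|m|\le h+1),$$ $$D_d=\sum_{i\in\Sigma,\,q\in Q,\ \hat d_i^q=d}a^0_i b_q ,$$ and for $p\in\mathbb Z$ $$\big(c(p),w(p)\big)=\begin{cases}\Big(\sum_{i,q}a^0_ib_q[\![\underline{\hat\sigma_i^q}]\!],\ \big(\sum_i a^0_i\big)\big(\sum_q b_q\big)\Big)& p=0,\\[2pt]\Big(\alpha^p,\ \sum_i a^p_i\Big)&0<|p|\le h,\\[2pt]\Big([\![\underline 0]\!],\ 1\Big)&|p|>h.\end{cases}$$ -/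

import Mathlib

open scoped TensorProduct
open TensorProduct

universe u w

namespace SweedlerLL

noncomputable section

section Cofree

variable (k : Type u) [Field k] (V : Type u) [AddCommGroup V] [Module k V]

/-- A cocommutative `k`-coalgebra with underlying space `k ^ dim`, with a linear map to `V`. -/
structure FinCoalg where
  dim : ℕ
  coalg : Coalgebra k (Fin dim → k)
  cocomm : Coalgebra.IsCocomm k (Fin dim → k)
  lin : (Fin dim → k) →ₗ[k] V

variable {k V}

/-- The underlying space of `i`; a synonym, so that the coordinatewise coalgebra structure on
`Fin n → k` is not found by instance search. -/
def FinCoalg.Carrier (i : FinCoalg k V) : Type u := Fin i.dim → k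

instance (i : FinCoalg k V) : AddCommGroup i.Carrier := inferInstanceAs (AddCommGroup (Fin i.dim → k))
instance (i : FinCoalg k V) : Module k i.Carrier := inferInstanceAs (Module k (Fin i.dim → k))
instance (i : FinCoalg k V) : Coalgebra k i.Carrier := i.coalg
instance (i : FinCoalg k V) : Coalgebra.IsCocomm k i.Carrier := i.cocomm

/-- The linear map of `i` to `V`. -/
def FinCoalg.toV (i : FinCoalg k V) : i.Carrier →ₗ[k] V := i.lin

variable (k V)

open scoped Classical in
/-- The direct sum of all cocommutative coalgebras `k ^ n` over `V`. -/
abbrev BigSum : Type u := Π₀ i : FinCoalg k V, i.Carrier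

open scoped Classical in
instance : Coalgebra k (BigSum k V) := DFinsupp.instCoalgebra k _ _
open scoped Classical in
instance : Coalgebra.IsCocomm k (BigSum k V) := DFinsupp.instIsCocomm k _ _

open scoped Classical in
/-- The linear map `⊕ᵢ Cᵢ → V`. -/
def BigSum.toV : BigSum k V →ₗ[k] V := DFinsupp.lsum ℕ fun i => i.toV


/-- The largest coideal of `⊕ᵢ Cᵢ` on which the map to `V` vanishes. -/
def bangIdeal : Submodule k (BigSum k V) :=
  sSup {I | I.IsCoideal ∧ I ≤ LinearMap.ker (BigSum.toV k V)}

variable {k V} in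
theorem le_bangIdeal {I : Submodule k (BigSum k V)} (hI : I.IsCoideal)
    (h : I ≤ LinearMap.ker (BigSum.toV k V)) : I ≤ bangIdeal k V :=
  le_sSup ⟨hI, h⟩

theorem bangIdeal_le : bangIdeal k V ≤ LinearMap.ker (BigSum.toV k V) :=
  sSup_le fun _ h => h.2

instance : (bangIdeal k V).IsCoideal where
  counit_eq_zero := by
    have : bangIdeal k V ≤ LinearMap.ker (Coalgebra.counit (R := k) (A := BigSum k V)) :=
      sSup_le fun I h x hx => h.1.counit_eq_zero hx
    exact fun x hx => this hx
  map_mkQ_comul_eq_zero := by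
    have : bangIdeal k V ≤ LinearMap.ker
        (TensorProduct.map (bangIdeal k V).mkQ (bangIdeal k V).mkQ ∘ₗ
          (Coalgebra.comul (R := k) (A := BigSum k V))) := by
      refine sSup_le fun I h x hx => ?_
      have hle : I ≤ bangIdeal k V := le_sSup h
      have e : (bangIdeal k V).mkQ = I.liftQ (bangIdeal k V).mkQ (by simpa using hle) ∘ₗ I.mkQ :=
        (Submodule.liftQ_mkQ _ _ _).symm
      rw [LinearMap.mem_ker, LinearMap.comp_apply, e, TensorProduct.map_comp,
        LinearMap.comp_apply, h.1.map_mkQ_comul_eq_zero hx, map_zero]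
    exact fun x hx => this hx

/-- The Sweedler coalgebra `!V`: the cofree cocommutative coalgebra on `V`, built as the quotient
of the direct sum of all cocommutative coalgebras `k ^ n` over `V` by the largest coideal that is
killed by the map to `V`. Its universal property is `existsUnique_bangLift`. -/
def Bang : Type u := BigSum k V ⧸ bangIdeal k V

instance : AddCommGroup (Bang k V) := inferInstanceAs (AddCommGroup (_ ⧸ bangIdeal k V))
instance : Module k (Bang k V) := inferInstanceAs (Module k (_ ⧸ bangIdeal k V))
instance : Coalgebra k (Bang k V) := inferInstanceAs (Coalgebra k (_ ⧸ bangIdeal k V))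

/-- The quotient map. -/
def bangMk : BigSum k V →ₗc[k] Bang k V := Coalgebra.Quotient.mkQCoalgHom (bangIdeal k V)

theorem bangMk_surjective : Function.Surjective (bangMk k V) :=
  Submodule.mkQ_surjective (bangIdeal k V)

variable {k V} in
theorem bangMk_eq_iff {x y : BigSum k V} : bangMk k V x = bangMk k V y ↔ x - y ∈ bangIdeal k V :=
  Submodule.Quotient.eq (bangIdeal k V)

instance : Coalgebra.IsCocomm k (Bang k V) where
  comm_comp_comul := by
    ext x
    obtain ⟨x, rfl⟩ := bangMk_surjective k V x
    have := CoalgHomClass.map_comp_comul_apply (bangMk k V) x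
    simp only [LinearMap.comp_apply, LinearEquiv.coe_coe]
    rw [← this, ← TensorProduct.map_comm, Coalgebra.comm_comul]

/-- The universal map `d : !V → V`. -/
def bangD : Bang k V →ₗ[k] V := (bangIdeal k V).liftQ (BigSum.toV k V) (bangIdeal_le k V)

theorem bangD_mk (x : BigSum k V) : bangD k V (bangMk k V x) = BigSum.toV k V x := rfl

variable {k V}

theorem isCoideal_range_sub {X S : Type*} [AddCommGroup X] [Module k X] [Coalgebra k X]
    [AddCommGroup S] [Module k S] [Coalgebra k S] (F G : X →ₗc[k] S) :
    (LinearMap.range ((F : X →ₗ[k] S) - (G : X →ₗ[k] S))).IsCoideal where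
  counit_eq_zero := by
    rintro _ ⟨x, rfl⟩
    simp
  map_mkQ_comul_eq_zero := by
    rintro _ ⟨x, rfl⟩
    set I := LinearMap.range ((F : X →ₗ[k] S) - (G : X →ₗ[k] S))
    have e : I.mkQ ∘ₗ (F : X →ₗ[k] S) = I.mkQ ∘ₗ (G : X →ₗ[k] S) := by
      ext y
      exact (Submodule.Quotient.eq I).2 ⟨y, rfl⟩
    simp only [LinearMap.sub_apply, map_sub, sub_eq_zero]
    have h1 := CoalgHomClass.map_comp_comul_apply F x
    have h2 := CoalgHomClass.map_comp_comul_apply G x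
    simp only [CoalgHom.coe_toLinearMap]
    rw [← h1, ← h2, ← LinearMap.comp_apply, ← TensorProduct.map_comp, e, TensorProduct.map_comp,
      LinearMap.comp_apply]

/-- Two coalgebra morphisms into `⊕ᵢ Cᵢ` over `V` agree in `!V`. -/
theorem bangMk_hom_eq {X : Type*} [AddCommGroup X] [Module k X] [Coalgebra k X]
    (F G : X →ₗc[k] BigSum k V)
    (h : ∀ x, BigSum.toV k V (F x) = BigSum.toV k V (G x)) (x : X) :
    bangMk k V (F x) = bangMk k V (G x) := by
  rw [bangMk_eq_iff]
  refine le_bangIdeal (isCoideal_range_sub F G) ?_ ⟨x, rfl⟩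
  rintro _ ⟨y, rfl⟩
  simp [h]

theorem bang_hom_ext {X : Type*} [AddCommGroup X] [Module k X] [Coalgebra k X]
    (F G : X →ₗc[k] Bang k V) (h : ∀ x, bangD k V (F x) = bangD k V (G x)) : F = G := by
  let J := LinearMap.range ((F : X →ₗ[k] Bang k V) - (G : X →ₗ[k] Bang k V))
  have hJ : J.IsCoideal := isCoideal_range_sub F G
  let π : BigSum k V →ₗ[k] Bang k V := (bangMk k V : BigSum k V →ₗ[k] Bang k V)
  let I := J.comap π
  have hle : bangIdeal k V ≤ I := fun y hy => by
    have : π y = 0 := (Submodule.Quotient.mk_eq_zero (bangIdeal k V)).2 hy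
    simp [I, this]
  let ψ₀ : Bang k V →ₗ[k] BigSum k V ⧸ I := (bangIdeal k V).liftQ I.mkQ (by simpa using hle)
  have hψ₀ : ∀ y, ψ₀ (π y) = I.mkQ y := fun y => rfl
  let ψ : Bang k V ⧸ J →ₗ[k] BigSum k V ⧸ I := J.liftQ ψ₀ (by
    intro z hz
    obtain ⟨y, rfl⟩ := bangMk_surjective k V z
    exact (hψ₀ y).trans ((Submodule.Quotient.mk_eq_zero I).2 hz))
  have hψ : ψ ∘ₗ (J.mkQ ∘ₗ π) = I.mkQ := rfl
  have hI : I.IsCoideal := by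
    constructor
    · intro y hy
      have := hJ.counit_eq_zero hy
      simpa [π] using this
    · intro y hy
      have h1 := hJ.map_mkQ_comul_eq_zero hy
      have h2 := CoalgHomClass.map_comp_comul_apply (bangMk k V) y
      rw [← hψ, TensorProduct.map_comp, TensorProduct.map_comp, LinearMap.comp_apply,
        LinearMap.comp_apply, h2]
      exact (congrArg _ h1).trans (map_zero _)
  have hker : I ≤ LinearMap.ker (BigSum.toV k V) := by
    rintro y ⟨x, hx⟩
    rw [LinearMap.mem_ker, ← bangD_mk]
    change bangD k V (π y) = 0
    rw [← hx]
    simp [h]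
  ext x
  obtain ⟨y, hy⟩ := bangMk_surjective k V (F x - G x)
  have : y ∈ I := ⟨x, hy.symm⟩
  have h3 := (Submodule.Quotient.mk_eq_zero (bangIdeal k V)).2 (le_bangIdeal hI hker this)
  exact sub_eq_zero.1 (hy.symm.trans h3)

section Lift

variable {C : Type*} [AddCommGroup C] [Module k C] [Coalgebra k C]

theorem tensor_eq_zero_of_dual {M N : Type*} [AddCommGroup M] [Module k M] [AddCommGroup N]
    [Module k N] (t : M ⊗[k] N)
    (h : ∀ g : N →ₗ[k] k, TensorProduct.rid k M (g.lTensor M t) = 0) : t = 0 := by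
  let b := Module.Basis.ofVectorSpace k N
  obtain ⟨c, hc⟩ := TensorProduct.eq_repr_basis_right b t
  have : c = 0 := by
    ext i
    have := h (b.coord i)
    rw [← hc] at this
    rw [Finsupp.sum, map_sum, map_sum, Finset.sum_eq_single i] at this
    · simpa using this
    · intro l _ hl
      simp [hl]
    · intro hi
      simp [Finsupp.notMem_support_iff.1 hi]
  rw [← hc, this]; simp

/-- `X` is a finite-dimensional subcoalgebra of `C`. -/
def IsFinSub (D : Submodule k C) : Prop :=
  FiniteDimensional k D ∧ ∀ x ∈ D, Coalgebra.comul (R := k) x ∈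
    LinearMap.range (TensorProduct.map D.subtype D.subtype)

theorem IsFinSub.sup {D E : Submodule k C} (hD : IsFinSub D) (hE : IsFinSub E) :
    IsFinSub (D ⊔ E) := by
  obtain ⟨h1, h2⟩ := hD
  obtain ⟨h3, h4⟩ := hE
  refine ⟨inferInstance, ?_⟩
  have key : ∀ {A B : Submodule k C}, A ≤ B →
      LinearMap.range (TensorProduct.map A.subtype A.subtype) ≤
        LinearMap.range (TensorProduct.map B.subtype B.subtype) := by
    rintro A B h _ ⟨y, rfl⟩
    refine ⟨TensorProduct.map (Submodule.inclusion h) (Submodule.inclusion h) y, ?_⟩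
    rw [← LinearMap.comp_apply, ← TensorProduct.map_comp]
    rfl
  have : D ⊔ E ≤ (LinearMap.range (TensorProduct.map (D ⊔ E).subtype (D ⊔ E).subtype)).comap
      (Coalgebra.comul (R := k)) :=
    sup_le (fun x hx => key le_sup_left (h2 x hx)) (fun x hx => key le_sup_right (h4 x hx))
  exact fun x hx => this hx

open scoped Classical in
theorem exists_isFinSub [Coalgebra.IsCocomm k C] (c : C) : ∃ D : Submodule k C, IsFinSub D ∧ c ∈ D := by
  let Φ : (C →ₗ[k] k) →ₗ[k] C :=
    { toFun := fun g => TensorProduct.rid k C (g.lTensor C (Coalgebra.comul c))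
      map_add' := by intro g h; simp [LinearMap.lTensor_add]
      map_smul' := by intro r g; simp [LinearMap.lTensor_smul] }
  let D := LinearMap.range Φ
  obtain ⟨p, hp⟩ := D.subtype.exists_leftInverse_of_injective (by simp)
  let P : C →ₗ[k] C := D.subtype ∘ₗ p
  have hP : ∀ x ∈ D, P x = x := fun x hx => by
    have := LinearMap.congr_fun hp ⟨x, hx⟩
    simpa [P] using congrArg Subtype.val this
  have h1 : P.rTensor C (Coalgebra.comul c) = Coalgebra.comul (R := k) c := by
    rw [← sub_eq_zero]
    apply tensor_eq_zero_of_dual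
    intro g
    have e : ∀ t : C ⊗[k] C, TensorProduct.rid k C (g.lTensor C (P.rTensor C t)) =
        P (TensorProduct.rid k C (g.lTensor C t)) := by
      intro t
      induction t with
      | zero => simp
      | add a b ha hb => simp only [map_add, ha, hb]
      | tmul a b => simp
    rw [map_sub, map_sub, e, sub_eq_zero]
    exact hP _ ⟨g, rfl⟩
  refine ⟨D, ⟨?_, ?_⟩, ⟨Coalgebra.counit, by simp [Φ]⟩⟩
  · obtain ⟨S, hS⟩ := TensorProduct.exists_finset (R := k) (Coalgebra.comul (R := k) c)
    have : D ≤ Submodule.span k (S.image Prod.fst : Finset C) := by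
      rintro _ ⟨g, rfl⟩
      change TensorProduct.rid k C (g.lTensor C (Coalgebra.comul c)) ∈ _
      rw [hS]
      simp only [map_sum, LinearMap.lTensor_tmul, TensorProduct.rid_tmul]
      exact Submodule.sum_mem _ fun i hi => Submodule.smul_mem _ _
        (Submodule.subset_span (by simpa using ⟨i.2, hi⟩))
    exact Submodule.finiteDimensional_of_le this
  · rintro _ ⟨g, rfl⟩
    set x := Φ g with hx
    let H : C →ₗ[k] C := (TensorProduct.rid k C).toLinearMap ∘ₗ g.lTensor C ∘ₗ Coalgebra.comul
    have h2 : Coalgebra.comul (R := k) x = H.lTensor C (Coalgebra.comul c) := by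
      have e : ∀ t : C ⊗[k] C, Coalgebra.comul (R := k) (TensorProduct.rid k C (g.lTensor C t)) =
          ((TensorProduct.rid k C).toLinearMap ∘ₗ g.lTensor C).lTensor C
            (TensorProduct.assoc k C C C ((Coalgebra.comul (R := k)).rTensor C t)) := by
        intro t
        induction t with
        | zero => simp
        | add a b ha hb => simp only [map_add, ha, hb]
        | tmul a b =>
          simp only [LinearMap.lTensor_tmul, TensorProduct.rid_tmul, map_smul,
            LinearMap.rTensor_tmul]
          induction Coalgebra.comul (R := k) a with
          | zero => simp
          | add a b ha hb => simp only [map_add, smul_add, ha, hb, TensorProduct.add_tmul]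
          | tmul a a' => simp
      have := e (Coalgebra.comul c)
      rw [Coalgebra.coassoc_apply] at this
      rw [hx]
      refine this.trans ?_
      rw [← LinearMap.comp_apply, ← LinearMap.lTensor_comp]
      rfl
    have h3 : P.rTensor C (Coalgebra.comul x) = Coalgebra.comul (R := k) x := by
      rw [h2, ← LinearMap.comp_apply, LinearMap.rTensor_comp_lTensor,
        ← LinearMap.lTensor_comp_rTensor, LinearMap.comp_apply, h1]
    have h4 : P.lTensor C (Coalgebra.comul x) = Coalgebra.comul (R := k) x := by
      conv_lhs => rw [← Coalgebra.comm_comul k x]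
      rw [LinearMap.lTensor, TensorProduct.map_comm]
      change TensorProduct.comm k C C (P.rTensor C _) = _
      rw [h3, Coalgebra.comm_comul]
    refine ⟨TensorProduct.map p p (Coalgebra.comul x), ?_⟩
    rw [← LinearMap.comp_apply, ← TensorProduct.map_comp]
    change TensorProduct.map P P _ = _
    rw [← LinearMap.lTensor_comp_rTensor, LinearMap.comp_apply, h3, h4]

theorem retract_comul {X : Type*} [AddCommGroup X] [Module k X] (j : X →ₗ[k] C) (p : C →ₗ[k] X)
    (h : ∀ x, TensorProduct.map (j ∘ₗ p) (j ∘ₗ p) (Coalgebra.comul (R := k) (j x)) =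
      Coalgebra.comul (j x)) :
    TensorProduct.map j j ∘ₗ (TensorProduct.map p p ∘ₗ Coalgebra.comul ∘ₗ j) =
      Coalgebra.comul (R := k) ∘ₗ j := by
  ext x
  have := h x
  rw [TensorProduct.map_comp] at this
  exact this

/-- The coalgebra structure on a subcoalgebra, in coordinates: `j` includes it and `p` is a
projection onto it. -/
@[reducible] def coalgOfRetract {X : Type*} [AddCommGroup X] [Module k X] (j : X →ₗ[k] C) (p : C →ₗ[k] X)
    (hpj : p ∘ₗ j = LinearMap.id)
    (h : ∀ x, TensorProduct.map (j ∘ₗ p) (j ∘ₗ p) (Coalgebra.comul (R := k) (j x)) =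
      Coalgebra.comul (j x)) : Coalgebra k X where
  comul := TensorProduct.map p p ∘ₗ Coalgebra.comul ∘ₗ j
  counit := Coalgebra.counit ∘ₗ j
  coassoc := by
    set Δ := TensorProduct.map p p ∘ₗ Coalgebra.comul (R := k) ∘ₗ j
    have hj : TensorProduct.map j j ∘ₗ Δ = Coalgebra.comul (R := k) ∘ₗ j := retract_comul j p h
    have inj : Function.Injective (TensorProduct.map j (TensorProduct.map j j)) := by
      apply Function.LeftInverse.injective (g := TensorProduct.map p (TensorProduct.map p p))
      intro t
      rw [← LinearMap.comp_apply, ← TensorProduct.map_comp, ← TensorProduct.map_comp, hpj]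
      simp
    ext x
    apply inj
    have l : ∀ t : X ⊗[k] X, TensorProduct.map j (TensorProduct.map j j)
        (TensorProduct.assoc k X X X (Δ.rTensor X t)) =
        TensorProduct.assoc k C C C ((Coalgebra.comul (R := k)).rTensor C
          (TensorProduct.map j j t)) := by
      intro t
      rw [TensorProduct.map_map_assoc, ← LinearMap.comp_apply, LinearMap.map_comp_rTensor, hj,
        ← LinearMap.comp_apply, LinearMap.rTensor_comp_map]
    have r : ∀ t : X ⊗[k] X, TensorProduct.map j (TensorProduct.map j j) (Δ.lTensor X t) =
        (Coalgebra.comul (R := k)).lTensor C (TensorProduct.map j j t) := by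
      intro t
      rw [← LinearMap.comp_apply, LinearMap.map_comp_lTensor, hj,
        ← LinearMap.comp_apply, LinearMap.lTensor_comp_map]
    have hx : TensorProduct.map j j (Δ x) = _ := LinearMap.congr_fun hj x
    refine (l (Δ x)).trans (Eq.trans ?_ (r (Δ x)).symm)
    rw [hx]
    exact Coalgebra.coassoc_apply (j x)
  rTensor_counit_comp_comul := by
    have hj := retract_comul j p h
    have inj : Function.Injective (j.lTensor k) := by
      apply Function.LeftInverse.injective (g := p.lTensor k)
      intro t
      rw [← LinearMap.comp_apply, ← LinearMap.lTensor_comp, hpj]; simp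
    ext x
    apply inj
    have := LinearMap.congr_fun hj x
    simp only [LinearMap.comp_apply] at this ⊢
    rw [← LinearMap.comp_apply (j.lTensor k), LinearMap.lTensor_comp_rTensor,
      show TensorProduct.map ((Coalgebra.counit (R := k)) ∘ₗ j) j =
        (Coalgebra.counit (R := k)).rTensor C ∘ₗ TensorProduct.map j j by
          rw [LinearMap.rTensor_comp_map], LinearMap.comp_apply, this]
    simp
  lTensor_counit_comp_comul := by
    have hj := retract_comul j p h
    have inj : Function.Injective (j.rTensor k) := by
      apply Function.LeftInverse.injective (g := p.rTensor k)
      intro t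
      rw [← LinearMap.comp_apply, ← LinearMap.rTensor_comp, hpj]; simp
    ext x
    apply inj
    have := LinearMap.congr_fun hj x
    simp only [LinearMap.comp_apply] at this ⊢
    rw [← LinearMap.comp_apply (j.rTensor k), LinearMap.rTensor_comp_lTensor,
      show TensorProduct.map j ((Coalgebra.counit (R := k)) ∘ₗ j) =
        (Coalgebra.counit (R := k)).lTensor C ∘ₗ TensorProduct.map j j by
          rw [LinearMap.lTensor_comp_map], LinearMap.comp_apply, this]
    simp

theorem IsFinSub.exists_coords {D : Submodule k C} (hD : IsFinSub D) :
    ∃ (n : ℕ) (j : (Fin n → k) →ₗ[k] C) (p : C →ₗ[k] (Fin n → k)), p ∘ₗ j = LinearMap.id ∧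
      LinearMap.range j = D ∧
      ∀ x, TensorProduct.map (j ∘ₗ p) (j ∘ₗ p) (Coalgebra.comul (R := k) (j x)) =
        Coalgebra.comul (j x) := by
  obtain ⟨h1, h2⟩ := hD
  obtain ⟨q, hq⟩ := D.subtype.exists_leftInverse_of_injective (by simp)
  let e := (Module.finBasis k D).equivFun
  refine ⟨_, D.subtype ∘ₗ e.symm.toLinearMap, e.toLinearMap ∘ₗ q, ?_, ?_, fun x => ?_⟩
  · ext x : 1
    have := fun y : D => LinearMap.congr_fun hq y
    simp only [LinearMap.comp_apply, Submodule.subtype_apply, LinearMap.id_apply] at this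
    ext
    simp [this]
  · rw [LinearMap.range_comp]; simp
  · obtain ⟨t, ht⟩ := h2 _ (e.symm x).2
    have e1 : (D.subtype ∘ₗ e.symm.toLinearMap) ∘ₗ e.toLinearMap ∘ₗ q = D.subtype ∘ₗ q := by
      ext y; simp
    rw [e1]
    simp only [LinearMap.comp_apply, LinearEquiv.coe_coe, Submodule.subtype_apply]
    rw [← ht, ← LinearMap.comp_apply, ← TensorProduct.map_comp, LinearMap.comp_assoc, hq,
      LinearMap.comp_id]

theorem IsFinSub.exists_local [Coalgebra.IsCocomm k C] (f : C →ₗ[k] V) {D : Submodule k C}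
    (hD : IsFinSub D) :
    ∃ (i : FinCoalg k V) (j : i.Carrier →ₗc[k] C) (p : C →ₗ[k] i.Carrier),
      p ∘ₗ (j : i.Carrier →ₗ[k] C) = LinearMap.id ∧ LinearMap.range (j : i.Carrier →ₗ[k] C) = D ∧
      (∀ x, i.toV x = f (j x)) := by
  obtain ⟨n, j, p, hpj, hr, h⟩ := hD.exists_coords
  let co : Coalgebra k (Fin n → k) := coalgOfRetract j p hpj h
  let i : FinCoalg k V := ⟨n, co, ⟨by
    refine LinearMap.ext fun x => ?_
    change TensorProduct.comm k _ _ (TensorProduct.map p p (Coalgebra.comul (j x))) =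
      TensorProduct.map p p (Coalgebra.comul (j x))
    rw [← TensorProduct.map_comm, Coalgebra.comm_comul]⟩, f ∘ₗ j⟩
  refine ⟨i, ⟨j, rfl, retract_comul j p h⟩, p, hpj, hr, fun x => rfl⟩

open scoped Classical in
/-- The inclusion of a summand. -/
def bigSingle (i : FinCoalg k V) : i.Carrier →ₗc[k] BigSum k V where
  toLinearMap := DFinsupp.lsingle i
  counit_comp := by
    apply LinearMap.ext; intro x
    exact DFinsupp.counit_single k _ _ i x
  map_comp_comul := by
    apply LinearMap.ext; intro x
    exact (DFinsupp.comul_single k _ _ i x).symm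

theorem toV_bigSingle (i : FinCoalg k V) (x : i.Carrier) :
    BigSum.toV k V (bigSingle i x) = i.toV x := by
  classical
  exact DFinsupp.lsum_single _ _ _ _

/-- The universal property of `!V`. -/
theorem existsUnique_bangLift [Coalgebra.IsCocomm k C] (f : C →ₗ[k] V) :
    ∃! F : C →ₗc[k] Bang k V, ∀ c, bangD k V (F c) = f c := by
  have huniq : ∀ F G : C →ₗc[k] Bang k V, (∀ c, bangD k V (F c) = f c) →
      (∀ c, bangD k V (G c) = f c) → F = G :=
    fun F G hF hG => bang_hom_ext F G fun x => (hF x).trans (hG x).symm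
  choose i j p hpj hr hf using fun D : {D : Submodule k C // IsFinSub D} => D.2.exists_local f
  let L : {D : Submodule k C // IsFinSub D} → C →ₗ[k] Bang k V := fun D =>
    (bangMk k V : BigSum k V →ₗ[k] Bang k V) ∘ₗ
      (bigSingle (i D) : (i D).Carrier →ₗ[k] BigSum k V) ∘ₗ p D
  have hpj' : ∀ D y, p D (j D y) = y := fun D y => LinearMap.congr_fun (hpj D) y
  have hjp : ∀ D, ∀ x ∈ D.1, j D (p D x) = x := by
    intro D x hx
    rw [← hr D] at hx
    obtain ⟨y, rfl⟩ := hx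
    exact congrArg (j D) (hpj' D y)
  have hmono : ∀ D E, D.1 ≤ E.1 → ∀ x ∈ D.1, L D x = L E x := by
    intro D E hDE x hx
    have hjD : ∀ y, j D y ∈ E.1 := fun y => hDE (by rw [← hr D]; exact ⟨y, rfl⟩)
    have ejp : (j E : (i E).Carrier →ₗ[k] C) ∘ₗ p E ∘ₗ (j D : (i D).Carrier →ₗ[k] C) =
        (j D : (i D).Carrier →ₗ[k] C) := by
      ext y; exact hjp E _ (hjD y)
    let φ : (i D).Carrier →ₗc[k] (i E).Carrier :=
      { toLinearMap := p E ∘ₗ (j D : (i D).Carrier →ₗ[k] C)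
        counit_comp := by
          ext y
          have h1 := CoalgHomClass.counit_comp_apply (j E) (p E (j D y))
          rw [hjp E _ (hjD y)] at h1
          exact h1.symm.trans (CoalgHomClass.counit_comp_apply (j D) y)
        map_comp_comul := by
          ext y
          have inj : Function.Injective (TensorProduct.map (j E : (i E).Carrier →ₗ[k] C)
              (j E : (i E).Carrier →ₗ[k] C)) := by
            apply Function.LeftInverse.injective (g := TensorProduct.map (p E) (p E))
            intro t
            rw [← LinearMap.comp_apply, ← TensorProduct.map_comp, hpj]; simp
          apply inj
          have h1 := CoalgHomClass.map_comp_comul_apply (j E) (p E (j D y))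
          rw [hjp E _ (hjD y)] at h1
          have h2 := CoalgHomClass.map_comp_comul_apply (j D) y
          simp only [LinearMap.comp_apply]
          refine Eq.trans ?_ h1.symm
          rw [← h2, ← LinearMap.comp_apply, ← TensorProduct.map_comp, ejp] }
    have := bangMk_hom_eq (bigSingle (i D)) ((bigSingle (i E)).comp φ) (fun y => by
      change _ = BigSum.toV k V (bigSingle (i E) (p E (j D y)))
      rw [toV_bigSingle, toV_bigSingle, hf, hf, hjp E _ (hjD y)]) (p D x)
    refine this.trans ?_
    change bangMk k V (bigSingle (i E) (p E (j D (p D x)))) = _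
    rw [hjp D x hx]; rfl
  have hLeq : ∀ D E, ∀ x ∈ D.1, x ∈ E.1 → L D x = L E x := fun D E x hD hE =>
    (hmono D ⟨D.1 ⊔ E.1, D.2.sup E.2⟩ le_sup_left x hD).trans
      (hmono E ⟨D.1 ⊔ E.1, D.2.sup E.2⟩ le_sup_right x hE).symm
  choose S hS hSm using exists_isFinSub (k := k) (C := C)
  let T : C → {D : Submodule k C // IsFinSub D} := fun c => ⟨S c, hS c⟩
  have hT : ∀ D, ∀ x ∈ D.1, L (T x) x = L D x := fun D x hx => hLeq _ _ x (hSm x) hx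
  let F₀ : C →ₗ[k] Bang k V :=
    { toFun := fun c => L (T c) c
      map_add' := fun x y => by
        let D : {D : Submodule k C // IsFinSub D} := ⟨S x ⊔ S y, (hS x).sup (hS y)⟩
        have hx : x ∈ D.1 := (le_sup_left : S x ≤ S x ⊔ S y) (hSm x)
        have hy : y ∈ D.1 := (le_sup_right : S y ≤ S x ⊔ S y) (hSm y)
        simp only [hT D x hx, hT D y hy, hT D (x + y) (D.1.add_mem hx hy), map_add]
      map_smul' := fun r x => by
        simp only [hT (T x) (r • x) ((S x).smul_mem r (hSm x)), map_smul, RingHom.id_apply] }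
  have hF₀ : ∀ D, ∀ x ∈ D.1, F₀ x = L D x := hT
  let F : C →ₗc[k] Bang k V :=
    { toLinearMap := F₀
      counit_comp := by
        ext c
        change Coalgebra.counit (bangMk k V (bigSingle (i (T c)) (p (T c) c))) = _
        rw [CoalgHomClass.counit_comp_apply, CoalgHomClass.counit_comp_apply,
          ← CoalgHomClass.counit_comp_apply (j (T c)), hjp (T c) c (hSm c)]
      map_comp_comul := by
        ext c
        let D := T c
        change TensorProduct.map F₀ F₀ (Coalgebra.comul c) =
          Coalgebra.comul (bangMk k V (bigSingle (i D) (p D c)))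
        obtain ⟨t, ht⟩ := D.2.2 c (hSm c)
        have e : F₀ ∘ₗ D.1.subtype = L D ∘ₗ D.1.subtype := by
          ext x; exact hF₀ D x x.2
        have h1 : TensorProduct.map F₀ F₀ (Coalgebra.comul c) =
            TensorProduct.map (L D) (L D) (Coalgebra.comul c) := by
          rw [← ht, ← LinearMap.comp_apply, ← TensorProduct.map_comp, e, TensorProduct.map_comp,
            LinearMap.comp_apply]
        rw [h1]
        have h2 : Coalgebra.comul (R := k) (p D c) =
            TensorProduct.map (p D) (p D) (Coalgebra.comul c) := by
          have h3 := CoalgHomClass.map_comp_comul_apply (j D) (p D c)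
          rw [hjp D c (hSm c)] at h3
          have h4 : TensorProduct.map (p D) (p D) ∘ₗ TensorProduct.map (j D : _ →ₗ[k] C)
              (j D : _ →ₗ[k] C) = LinearMap.id := by
            rw [← TensorProduct.map_comp, hpj, TensorProduct.map_id]
          rw [← h3]
          exact (LinearMap.congr_fun h4 _).symm
        rw [← CoalgHomClass.map_comp_comul_apply, ← CoalgHomClass.map_comp_comul_apply, h2]
        simp only [L, TensorProduct.map_comp, LinearMap.comp_apply] }
  refine ⟨F, fun c => ?_, fun G hG => huniq G F hG fun c => ?_⟩ <;>
  · change bangD k V (bangMk k V (bigSingle (i (T c)) (p (T c) c))) = f c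
    rw [bangD_mk, toV_bigSingle, hf, hjp (T c) c (hSm c)]

/-- The coalgebra morphism `C → !V` induced by a linear map `f : C → V`: the unique one whose
composite with `d : !V → V` is `f`. -/
def bangLift [Coalgebra.IsCocomm k C] (f : C →ₗ[k] V) : C →ₗc[k] Bang k V :=
  (existsUnique_bangLift f).choose

end Lift

/-- The vacuum vector `|∅⟩_P` of `!V` at `P : V`: the group-like element of `!V` over `P`, i.e. the
image of `1` under the coalgebra morphism `k → !V` induced by `1 ↦ P`. -/
def vacuum (P : V) : Bang k V := bangLift (LinearMap.toSpanSingleton k V P) 1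

end Cofree

end

/-! ### Intuitionistic linear logic -/

/-- Formulas of first-order intuitionistic linear logic with connectives `⊗`, `&`, `⊸`, `!`. -/
inductive Formula (α : Type w) : Type w
  | atom : α → Formula α
  | tensor : Formula α → Formula α → Formula α
  | amp : Formula α → Formula α → Formula α
  | limp : Formula α → Formula α → Formula α
  | bang : Formula α → Formula α

section Sequents

variable {α : Type w}

open Formula

/-- The left rules with a single premise. `LRule Θ Θ'` acts on a context by replacing the block `Θ`
of the premise by the block `Θ'` in the conclusion: exchange, `⊗L`, the two `&L`, dereliction,
weakening and contraction. -/
inductive LRule : List (Formula α) → List (Formula α) → Type w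
  | exch (A B : Formula α) : LRule [A, B] [B, A]
  | tensorL (A B : Formula α) : LRule [A, B] [tensor A B]
  | ampL0 (A B : Formula α) : LRule [A] [amp A B]
  | ampL1 (A B : Formula α) : LRule [B] [amp A B]
  | der (A : Formula α) : LRule [A] [bang A]
  | wk (A : Formula α) : LRule [] [bang A]
  | ctr (A : Formula α) : LRule [bang A, bang A] [bang A]

/-- Sequent calculus proofs: `Proof Γ A` is the type of proofs of the sequent `Γ ⊢ A`. -/
inductive Proof : List (Formula α) → Formula α → Type w
  | ax (A : Formula α) : Proof [A] A
  | cut {Γ : List (Formula α)} {A C : Formula α} (Δ₁ Δ₂ : List (Formula α)) :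
      Proof Γ A → Proof (Δ₁ ++ A :: Δ₂) C → Proof (Δ₁ ++ (Γ ++ Δ₂)) C
  | left {Θ Θ' : List (Formula α)} {C : Formula α} (r : LRule Θ Θ') (Δ₁ Δ₂ : List (Formula α)) :
      Proof (Δ₁ ++ (Θ ++ Δ₂)) C → Proof (Δ₁ ++ (Θ' ++ Δ₂)) C
  | tensorR {Γ Δ : List (Formula α)} {A B : Formula α} :
      Proof Γ A → Proof Δ B → Proof (Γ ++ Δ) (tensor A B)
  | limpR {Γ : List (Formula α)} {A B : Formula α} : Proof (A :: Γ) B → Proof Γ (limp A B)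
  | limpL {Γ : List (Formula α)} {A B C : Formula α} (Δ₁ Δ₂ : List (Formula α)) :
      Proof Γ A → Proof (Δ₁ ++ B :: Δ₂) C → Proof (Δ₁ ++ (Γ ++ limp A B :: Δ₂)) C
  | ampR {Γ : List (Formula α)} {A B : Formula α} : Proof Γ A → Proof Γ B → Proof Γ (amp A B)
  | prom {Γ : List (Formula α)} {A : Formula α} :
      Proof (Γ.map bang) A → Proof (Γ.map bang) (bang A)

namespace Proof

variable {Γ Δ Θ Θ' : List (Formula α)} {A B C D : Formula α}

/-- Transport along an equality of contexts (used only for reassociating lists). -/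
def recast (h : Γ = Δ) (p : Proof Γ A) : Proof Δ A := h ▸ p

/-- Exchanges moving `B` to the right past the block `Γ`. -/
def moveRight (B : Formula α) : (Γ Δ₁ Δ₂ : List (Formula α)) →
    Proof (Δ₁ ++ B :: (Γ ++ Δ₂)) C → Proof (Δ₁ ++ (Γ ++ B :: Δ₂)) C
  | [], _, _, p => p
  | A :: Γ, Δ₁, Δ₂, p =>
    recast (by simp) (moveRight B Γ (Δ₁ ++ [A]) Δ₂
      (recast (by simp) (left (.exch B A) Δ₁ (Γ ++ Δ₂) p)))

/-- Exchanges moving `B` to the left past the block `Γ`. -/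
def moveLeft (B : Formula α) : (Γ Δ₁ Δ₂ : List (Formula α)) →
    Proof (Δ₁ ++ (Γ ++ B :: Δ₂)) C → Proof (Δ₁ ++ B :: (Γ ++ Δ₂)) C
  | [], _, _, p => p
  | A :: Γ, Δ₁, Δ₂, p =>
    left (.exch A B) Δ₁ (Γ ++ Δ₂)
      (recast (by simp) (moveLeft B Γ (Δ₁ ++ [A]) Δ₂ (recast (by simp) p)))

/-- Weakenings introducing `!Γ`. -/
def wkList : (Γ Δ₁ Δ₂ : List (Formula α)) →
    Proof (Δ₁ ++ Δ₂) C → Proof (Δ₁ ++ (Γ.map bang ++ Δ₂)) C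
  | [], _, _, p => p
  | A :: Γ, Δ₁, Δ₂, p => left (.wk A) Δ₁ (Γ.map bang ++ Δ₂) (wkList Γ Δ₁ Δ₂ p)

/-- Contractions (and exchanges) merging two copies of `!Γ` into one. -/
def ctrList : (Γ Δ₁ Δ₂ : List (Formula α)) →
    Proof (Δ₁ ++ (Γ.map bang ++ (Γ.map bang ++ Δ₂))) C → Proof (Δ₁ ++ (Γ.map bang ++ Δ₂)) C
  | [], _, _, p => p
  | A :: Γ, Δ₁, Δ₂, p =>
    recast (by simp) (ctrList Γ (Δ₁ ++ [bang A]) Δ₂ (recast (by simp)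
      (left (.ctr A) Δ₁ (Γ.map bang ++ (Γ.map bang ++ Δ₂)) (recast (by simp)
        (moveLeft (bang A) (Γ.map bang) (Δ₁ ++ [bang A]) (Γ.map bang ++ Δ₂)
          (recast (by simp) p))))))

end Proof

open Proof

/-- Equivalence under cut-elimination: the congruence generated by the cut-elimination
transformations of intuitionistic linear logic. It relates proofs of `Γ ⊢ A` and `Δ ⊢ A` for lists
`Γ`, `Δ` that are equal up to reassociation, but possibly not definitionally. -/
inductive CutEq : {Γ Δ : List (Formula α)} → {A : Formula α} → Proof Γ A → Proof Δ A → Prop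
  -- equivalence relation
  | refl {Γ A} (p : Proof Γ A) : CutEq p p
  | symm {Γ Δ A} {p : Proof Γ A} {q : Proof Δ A} : CutEq p q → CutEq q p
  | trans {Γ Δ Θ A} {p : Proof Γ A} {q : Proof Δ A} {r : Proof Θ A} :
      CutEq p q → CutEq q r → CutEq p r
  -- compatibility with the rules
  | congr_cut {Γ A C} (Δ₁ Δ₂) {p p' : Proof Γ A} {q q' : Proof (Δ₁ ++ A :: Δ₂) C} :
      CutEq p p' → CutEq q q' → CutEq (cut Δ₁ Δ₂ p q) (cut Δ₁ Δ₂ p' q')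
  | congr_left {Θ Θ' C} (r : LRule Θ Θ') (Δ₁ Δ₂) {p p' : Proof (Δ₁ ++ (Θ ++ Δ₂)) C} :
      CutEq p p' → CutEq (left r Δ₁ Δ₂ p) (left r Δ₁ Δ₂ p')
  | congr_tensorR {Γ Δ A B} {p p' : Proof Γ A} {q q' : Proof Δ B} :
      CutEq p p' → CutEq q q' → CutEq (tensorR p q) (tensorR p' q')
  | congr_limpR {Γ A B} {p p' : Proof (A :: Γ) B} : CutEq p p' → CutEq (limpR p) (limpR p')
  | congr_limpL {Γ A B C} (Δ₁ Δ₂) {p p' : Proof Γ A} {q q' : Proof (Δ₁ ++ B :: Δ₂) C} :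
      CutEq p p' → CutEq q q' → CutEq (limpL Δ₁ Δ₂ p q) (limpL Δ₁ Δ₂ p' q')
  | congr_ampR {Γ A B} {p p' : Proof Γ A} {q q' : Proof Γ B} :
      CutEq p p' → CutEq q q' → CutEq (ampR p q) (ampR p' q')
  | congr_prom {Γ : List (Formula α)} {A} {p p' : Proof (Γ.map bang) A} :
      CutEq p p' → CutEq (prom p) (prom p')
  -- expansion of axioms
  | eta_tensor (A B) :
      CutEq (ax (tensor A B)) (left (.tensorL A B) [] [] (tensorR (Γ := [A]) (Δ := [B]) (ax A) (ax B)))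
  | eta_limp (A B) : CutEq (ax (limp A B)) (limpR (limpL [] [] (ax A) (ax B)))
  | eta_amp (A B) : CutEq (ax (amp A B))
      (ampR (left (.ampL0 A B) [] [] (ax A)) (left (.ampL1 A B) [] [] (ax B)))
  | eta_bang (A) :
      CutEq (ax (bang A)) (prom (Γ := [A]) (left (.der A) [] [] (ax A)))
  -- cut against an axiom
  | ax_cut {A C} (Δ₁ Δ₂) (q : Proof (Δ₁ ++ A :: Δ₂) C) : CutEq (cut Δ₁ Δ₂ (ax A) q) q
  | cut_ax {Γ A} (p : Proof Γ A) : CutEq (cut [] [] p (ax A)) p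
  -- cut against a cut
  | cut_assoc {Γ A B C} (Δ₁ Δ₂ Θ₁ Θ₂) (p : Proof Γ A) (q : Proof (Δ₁ ++ A :: Δ₂) B)
      (r : Proof (Θ₁ ++ B :: Θ₂) C) :
      CutEq (cut Θ₁ Θ₂ (cut Δ₁ Δ₂ p q) r)
        (cut (Θ₁ ++ Δ₁) (Δ₂ ++ Θ₂) p (recast (by simp) (cut Θ₁ Θ₂ q r)))
  | cut_comm {Γ Δ A B C} (Θ₁ Θ₂ Θ₃) (p : Proof Γ A) (q : Proof Δ B)
      (r : Proof (Θ₁ ++ A :: (Θ₂ ++ B :: Θ₃)) C) :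
      CutEq
        (cut Θ₁ (Θ₂ ++ (Δ ++ Θ₃)) p
          (recast (by simp) (cut (Θ₁ ++ A :: Θ₂) Θ₃ q (recast (by simp) r))))
        (cut (Θ₁ ++ (Γ ++ Θ₂)) Θ₃ q (recast (by simp) (cut Θ₁ (Θ₂ ++ B :: Θ₃) p r)))
  -- principal cuts
  | tensor_tensor {Γ Δ A B C} (Θ₁ Θ₂) (p : Proof Γ A) (q : Proof Δ B)
      (r : Proof (Θ₁ ++ A :: B :: Θ₂) C) :
      CutEq (cut Θ₁ Θ₂ (tensorR p q) (left (.tensorL A B) Θ₁ Θ₂ r))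
        (cut Θ₁ (Δ ++ Θ₂) p (recast (by simp) (cut (Θ₁ ++ [A]) Θ₂ q (recast (by simp) r))))
  | limp_limp {Γ Δ A B C} (Θ₁ Θ₂) (p : Proof (A :: Γ) B) (q : Proof Δ A)
      (r : Proof (Θ₁ ++ B :: Θ₂) C) :
      CutEq (cut (Θ₁ ++ Δ) Θ₂ (limpR p) (recast (by simp) (limpL Θ₁ Θ₂ q r)))
        (cut Θ₁ Θ₂ (cut [] Γ q p) r)
  | amp_amp0 {Γ A B C} (Θ₁ Θ₂) (p : Proof Γ A) (q : Proof Γ B) (r : Proof (Θ₁ ++ A :: Θ₂) C) :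
      CutEq (cut Θ₁ Θ₂ (ampR p q) (left (.ampL0 A B) Θ₁ Θ₂ r)) (cut Θ₁ Θ₂ p r)
  | amp_amp1 {Γ A B C} (Θ₁ Θ₂) (p : Proof Γ A) (q : Proof Γ B) (r : Proof (Θ₁ ++ B :: Θ₂) C) :
      CutEq (cut Θ₁ Θ₂ (ampR p q) (left (.ampL1 A B) Θ₁ Θ₂ r)) (cut Θ₁ Θ₂ q r)
  | prom_der {Γ : List (Formula α)} {A C} (Θ₁ Θ₂) (p : Proof (Γ.map bang) A)
      (r : Proof (Θ₁ ++ A :: Θ₂) C) :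
      CutEq (cut Θ₁ Θ₂ (prom p) (left (.der A) Θ₁ Θ₂ r)) (cut Θ₁ Θ₂ p r)
  | prom_wk {Γ : List (Formula α)} {A C} (Θ₁ Θ₂) (p : Proof (Γ.map bang) A)
      (r : Proof (Θ₁ ++ Θ₂) C) :
      CutEq (cut Θ₁ Θ₂ (prom p) (left (.wk A) Θ₁ Θ₂ r)) (wkList Γ Θ₁ Θ₂ r)
  | prom_ctr {Γ : List (Formula α)} {A C} (Θ₁ Θ₂) (p : Proof (Γ.map bang) A)
      (r : Proof (Θ₁ ++ bang A :: bang A :: Θ₂) C) :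
      CutEq (cut Θ₁ Θ₂ (prom p) (left (.ctr A) Θ₁ Θ₂ r))
        (ctrList Γ Θ₁ Θ₂ (cut Θ₁ (Γ.map bang ++ Θ₂) (prom p)
          (recast (by simp) (cut (Θ₁ ++ [bang A]) Θ₂ (prom p) (recast (by simp) r)))))
  | prom_prom {Γ : List (Formula α)} {A B} (Θ₁ Θ₂ : List (Formula α)) (p : Proof (Γ.map bang) A)
      (q : Proof ((Θ₁ ++ A :: Θ₂).map bang) B) :
      CutEq
        (cut (Θ₁.map bang) (Θ₂.map bang) (prom p) (recast (by simp) (prom q)))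
        (prom (Γ := Θ₁ ++ (Γ ++ Θ₂))
          (recast (by simp) (cut (Θ₁.map bang) (Θ₂.map bang) (prom p) (recast (by simp) q))))
  -- cut of a formula that was just exchanged
  | cut_exch_left {Γ A B C} (Θ₁ Θ₂) (p : Proof Γ B) (r : Proof (Θ₁ ++ A :: B :: Θ₂) C) :
      CutEq (cut Θ₁ (A :: Θ₂) p (left (.exch A B) Θ₁ Θ₂ r))
        (moveRight A Γ Θ₁ Θ₂ (recast (by simp) (cut (Θ₁ ++ [A]) Θ₂ p (recast (by simp) r))))
  | cut_exch_right {Γ A B C} (Θ₁ Θ₂) (p : Proof Γ A) (r : Proof (Θ₁ ++ A :: B :: Θ₂) C) :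
      CutEq (cut (Θ₁ ++ [B]) Θ₂ p (recast (by simp) (left (.exch A B) Θ₁ Θ₂ r)))
        (moveLeft B Γ Θ₁ Θ₂ (cut Θ₁ (B :: Θ₂) p r))
  -- the left premise of the cut ends with a left rule
  | left_cut {Θ Θ' A C} (r : LRule Θ Θ') (Δ₁ Δ₂ Θ₁ Θ₂) (p : Proof (Δ₁ ++ (Θ ++ Δ₂)) A)
      (q : Proof (Θ₁ ++ A :: Θ₂) C) :
      CutEq (cut Θ₁ Θ₂ (left r Δ₁ Δ₂ p) q)
        (left r (Θ₁ ++ Δ₁) (Δ₂ ++ Θ₂) (recast (by simp) (cut Θ₁ Θ₂ p q)))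
  | limpL_cut {Γ A B D C} (Δ₁ Δ₂ Θ₁ Θ₂) (p₁ : Proof Γ A) (p₂ : Proof (Δ₁ ++ B :: Δ₂) D)
      (q : Proof (Θ₁ ++ D :: Θ₂) C) :
      CutEq (cut Θ₁ Θ₂ (limpL Δ₁ Δ₂ p₁ p₂) q)
        (limpL (B := B) (Θ₁ ++ Δ₁) (Δ₂ ++ Θ₂) p₁ (recast (by simp) (cut Θ₁ Θ₂ p₂ q)))
  -- the right premise of the cut ends with a rule that does not act on the cut formula
  | cut_left_after {Γ Θ Θ' A C} (r : LRule Θ Θ') (Δ₁ Δ₂ Δ₃) (p : Proof Γ A)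
      (q : Proof (Δ₁ ++ A :: (Δ₂ ++ (Θ ++ Δ₃))) C) :
      CutEq
        (cut Δ₁ (Δ₂ ++ (Θ' ++ Δ₃)) p
          (recast (by simp) (left r (Δ₁ ++ A :: Δ₂) Δ₃ (recast (by simp) q))))
        (left r (Δ₁ ++ (Γ ++ Δ₂)) Δ₃ (recast (by simp) (cut Δ₁ (Δ₂ ++ (Θ ++ Δ₃)) p q)))
  | cut_left_before {Γ Θ Θ' A C} (r : LRule Θ Θ') (Δ₁ Δ₂ Δ₃) (p : Proof Γ A)
      (q : Proof (Δ₁ ++ (Θ ++ (Δ₂ ++ A :: Δ₃))) C) :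
      CutEq
        (cut (Δ₁ ++ (Θ' ++ Δ₂)) Δ₃ p (recast (by simp) (left r Δ₁ (Δ₂ ++ A :: Δ₃) q)))
        (left r Δ₁ (Δ₂ ++ (Γ ++ Δ₃))
          (recast (by simp) (cut (Δ₁ ++ (Θ ++ Δ₂)) Δ₃ p (recast (by simp) q))))
  | cut_tensorR_left {Γ Δ A B C} (Δ₁ Δ₂) (p : Proof Γ A) (q₁ : Proof (Δ₁ ++ A :: Δ₂) B)
      (q₂ : Proof Δ C) :
      CutEq (cut Δ₁ (Δ₂ ++ Δ) p (recast (by simp) (tensorR q₁ q₂)))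
        (tensorR (cut Δ₁ Δ₂ p q₁) q₂)
  | cut_tensorR_right {Γ Δ A B C} (Δ₁ Δ₂) (p : Proof Γ A) (q₁ : Proof Δ B)
      (q₂ : Proof (Δ₁ ++ A :: Δ₂) C) :
      CutEq (cut (Δ ++ Δ₁) Δ₂ p (recast (by simp) (tensorR q₁ q₂)))
        (tensorR q₁ (cut Δ₁ Δ₂ p q₂))
  | cut_limpR {Γ A B C} (Δ₁ Δ₂) (p : Proof Γ A) (q : Proof (B :: (Δ₁ ++ A :: Δ₂)) C) :
      CutEq (cut Δ₁ Δ₂ p (limpR q)) (limpR (cut (B :: Δ₁) Δ₂ p q))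
  | cut_ampR {Γ A B C} (Δ₁ Δ₂) (p : Proof Γ A) (q₁ : Proof (Δ₁ ++ A :: Δ₂) B)
      (q₂ : Proof (Δ₁ ++ A :: Δ₂) C) :
      CutEq (cut Δ₁ Δ₂ p (ampR q₁ q₂)) (ampR (cut Δ₁ Δ₂ p q₁) (cut Δ₁ Δ₂ p q₂))
  | cut_limpL_arg {Γ A B D C} (Δ₁ Δ₂ Θ₁ Θ₂) (p : Proof Γ A) (q₁ : Proof (Δ₁ ++ A :: Δ₂) B)
      (q₂ : Proof (Θ₁ ++ D :: Θ₂) C) :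
      CutEq (cut (Θ₁ ++ Δ₁) (Δ₂ ++ limp B D :: Θ₂) p (recast (by simp) (limpL Θ₁ Θ₂ q₁ q₂)))
        (limpL Θ₁ Θ₂ (cut Δ₁ Δ₂ p q₁) q₂)
  | cut_limpL_before {Γ Δ A B D C} (Δ₁ Δ₂ Θ₂) (p : Proof Γ A) (q₁ : Proof Δ B)
      (q₂ : Proof (Δ₁ ++ A :: (Δ₂ ++ D :: Θ₂)) C) :
      CutEq
        (cut Δ₁ (Δ₂ ++ (Δ ++ limp B D :: Θ₂)) p
          (recast (by simp) (limpL (B := D) (Δ₁ ++ A :: Δ₂) Θ₂ q₁ (recast (by simp) q₂))))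
        (limpL (B := D) (Δ₁ ++ (Γ ++ Δ₂)) Θ₂ q₁ (recast (by simp) (cut Δ₁ (Δ₂ ++ D :: Θ₂) p q₂)))
  | cut_limpL_after {Γ Δ A B D C} (Θ₁ Δ₁ Δ₂) (p : Proof Γ A) (q₁ : Proof Δ B)
      (q₂ : Proof (Θ₁ ++ D :: (Δ₁ ++ A :: Δ₂)) C) :
      CutEq
        (cut (Θ₁ ++ (Δ ++ limp B D :: Δ₁)) Δ₂ p
          (recast (by simp) (limpL (B := D) Θ₁ (Δ₁ ++ A :: Δ₂) q₁ q₂)))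
        (limpL (B := D) Θ₁ (Δ₁ ++ (Γ ++ Δ₂)) q₁
          (recast (by simp) (cut (Θ₁ ++ D :: Δ₁) Δ₂ p (recast (by simp) q₂))))

/-! ### Plain and component-wise plain proofs -/

/-- The context `n₁ A₁, …, n_r A_r`, with each formula passed through `f`. -/
def multCtx (f : Formula α → Formula α) :
    (As : List (Formula α)) → (Fin As.length → ℕ) → List (Formula α)
  | [], _ => []
  | A :: As, d => List.replicate (d 0) (f A) ++ multCtx f As (fun i => d i.succ)

theorem map_multCtx (f : Formula α → Formula α) : (As : List (Formula α)) →
    (d : Fin As.length → ℕ) → (multCtx id As d).map f = multCtx f As d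
  | [], _ => rfl
  | A :: As, d => by
    simp only [multCtx, List.map_append, List.map_replicate, map_multCtx f As, id]

namespace Proof

variable {C : Formula α}

/-- Derelictions applied to every formula of the block `Γ`. -/
def derList : (Γ Δ₁ Δ₂ : List (Formula α)) →
    Proof (Δ₁ ++ (Γ ++ Δ₂)) C → Proof (Δ₁ ++ (Γ.map bang ++ Δ₂)) C
  | [], _, _, p => p
  | A :: Γ, Δ₁, Δ₂, p =>
    recast (by simp) (derList Γ (Δ₁ ++ [bang A]) Δ₂
      (recast (by simp) (left (.der A) Δ₁ (Γ ++ Δ₂) p)))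

/-- From `n` copies of `!A` to one: a weakening if `n = 0`, and `n - 1` contractions if `n ≥ 1`. -/
def collapse (A : Formula α) : (n : ℕ) → (Δ₁ Δ₂ : List (Formula α)) →
    Proof (Δ₁ ++ (List.replicate n (bang A) ++ Δ₂)) C → Proof (Δ₁ ++ bang A :: Δ₂) C
  | 0, Δ₁, Δ₂, p => left (.wk A) Δ₁ Δ₂ p
  | 1, _, _, p => p
  | n + 2, Δ₁, Δ₂, p =>
    collapse A (n + 1) Δ₁ Δ₂ (left (.ctr A) Δ₁ (List.replicate n (bang A) ++ Δ₂) p)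

/-- From `n₁ !A₁, …, n_r !A_r` to `!A₁, …, !A_r` by contractions and weakenings. -/
def collapseList : (As : List (Formula α)) → (d : Fin As.length → ℕ) → (Δ₁ : List (Formula α)) →
    Proof (Δ₁ ++ multCtx bang As d) C → Proof (Δ₁ ++ As.map bang) C
  | [], _, _, p => p
  | A :: As, d, Δ₁, p =>
    recast (by simp) (collapseList As (fun i => d i.succ) (Δ₁ ++ [bang A])
      (recast (by simp) (collapse A (d 0) Δ₁ (multCtx bang As (fun i => d i.succ)) p)))

/-- The proof of `!A₁, …, !A_r ⊢ B` obtained from a proof of `n₁ A₁, …, n_r A_r ⊢ B` by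
derelictions followed by contractions and weakenings. -/
def plainForm (As : List (Formula α)) (d : Fin As.length → ℕ) (p : Proof (multCtx id As d) C) :
    Proof (As.map bang) C :=
  collapseList As d []
    (recast (by simp [map_multCtx]) (derList (multCtx id As d) [] [] (recast (by simp) p)))

end Proof

/-- Plain proofs of `!A₁, …, !A_r ⊢ B`. -/
def IsPlain (As : List (Formula α)) {B : Formula α} (ψ : Proof (As.map bang) B) : Prop :=
  ∃ (d : Fin As.length → ℕ) (p : Proof (multCtx id As d) B), CutEq ψ (plainForm As d p)

/-- The formula `!B₁ ⊗ (!B₂ ⊗ ⋯ ⊗ !B)` for a list `Bs = [B₁, B₂, …]` and a last formula `B`. -/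
def tensorBangs : List (Formula α) → Formula α → Formula α
  | [], B => bang B
  | B₁ :: Bs, B => tensor (bang B₁) (tensorBangs Bs B)

/-- `m + 1` copies of the context `Γ`. -/
def copies (Γ : List (Formula α)) : ℕ → List (Formula α)
  | 0 => Γ
  | m + 1 => Γ ++ copies Γ m

namespace Proof

/-- The tensor product of the promotions of proofs `ψᵢ : !A₁, …, !A_r ⊢ Bᵢ`. -/
def tensorProms (As : List (Formula α)) {B : Formula α} : (Bs : List (Formula α)) →
    (∀ i : Fin Bs.length, Proof (As.map bang) (Bs.get i)) → Proof (As.map bang) B →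
    Proof (copies (As.map bang) Bs.length) (tensorBangs Bs B)
  | [], _, χ => prom χ
  | _ :: Bs, ψ, χ => tensorR (prom (ψ 0)) (tensorProms As Bs (fun i => ψ i.succ) χ)

/-- Contractions merging the copies of `!A₁, …, !A_r` into one. -/
def ctrCopies (As : List (Formula α)) {C : Formula α} : (m : ℕ) → (Δ₁ : List (Formula α)) →
    Proof (Δ₁ ++ copies (As.map bang) m) C → Proof (Δ₁ ++ As.map bang) C
  | 0, _, p => p
  | m + 1, Δ₁, p =>
    recast (by simp) (ctrList As Δ₁ [] (recast (by simp)
      (ctrCopies As m (Δ₁ ++ As.map bang) (recast (by simp [copies]) p))))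

/-- The proof of `!A₁, …, !A_r ⊢ !B₁ ⊗ ⋯ ⊗ !B` with the given components. -/
def ofComponents (As : List (Formula α)) {B : Formula α} (Bs : List (Formula α))
    (ψ : ∀ i : Fin Bs.length, Proof (As.map bang) (Bs.get i)) (χ : Proof (As.map bang) B) :
    Proof (As.map bang) (tensorBangs Bs B) :=
  ctrCopies As Bs.length [] (tensorProms As Bs ψ χ)

/-- From `!A₁, …, !A_r, !A ⊢ C` to `!A₁ ⊗ ⋯ ⊗ !A_r ⊗ !A ⊢ C` by `⊗L` rules. -/
def tensorLList {C : Formula α} (A : Formula α) : (As Δ₁ : List (Formula α)) →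
    Proof (Δ₁ ++ (As ++ [A]).map bang) C → Proof (Δ₁ ++ [tensorBangs As A]) C
  | [], _, p => p
  | A₁ :: As, Δ₁, p =>
    left (.tensorL (bang A₁) (tensorBangs As A)) Δ₁ []
      (recast (by simp) (tensorLList A As (Δ₁ ++ [bang A₁]) (recast (by simp) p)))

end Proof

/-- Component-wise plain proofs of `!A₁, …, !A_r ⊢ !B₁ ⊗ ⋯ ⊗ !B`. -/
def IsComponentwisePlainSeq (As Bs : List (Formula α)) (B : Formula α)
    (ψ : Proof (As.map bang) (tensorBangs Bs B)) : Prop :=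
  ∃ (φ : ∀ i : Fin Bs.length, Proof (As.map bang) (Bs.get i)) (χ : Proof (As.map bang) B),
    (∀ i, IsPlain As (φ i)) ∧ IsPlain As χ ∧ CutEq ψ (ofComponents As Bs φ χ)

/-- Component-wise plain proofs of `!A₁ ⊗ ⋯ ⊗ !A ⊢ !B₁ ⊗ ⋯ ⊗ !B`: those obtained, up to
cut-elimination, from a component-wise plain proof of `!A₁, …, !A ⊢ !B₁ ⊗ ⋯ ⊗ !B` by `⊗L`. -/
def IsComponentwisePlain (As : List (Formula α)) (A : Formula α) (Bs : List (Formula α))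
    (B : Formula α) (ψ : Proof [tensorBangs As A] (tensorBangs Bs B)) : Prop :=
  ∃ φ : Proof ((As ++ [A]).map bang) (tensorBangs Bs B),
    IsComponentwisePlainSeq (As ++ [A]) Bs B φ ∧ CutEq ψ (tensorLList A As [] φ)

/-! ### Booleans and Turing machine configurations as proofs -/

/-- `Aⁿ = A & ⋯ & A` with `n ≥ 1` copies (the value at `n = 0` is irrelevant). -/
def Formula.pow (A : Formula α) : ℕ → Formula α
  | 0 => A
  | 1 => A
  | n + 2 => amp A (Formula.pow A (n + 1))

/-- The type `Aⁿ ⊸ A` of `n`-booleans. -/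
def nbool (n : ℕ) (A : Formula α) : Formula α := limp (A.pow n) A

/-- The proof `&Lᵢ` of `Aⁿ ⊢ A` from the axiom. -/
def projProof (A : Formula α) : (n : ℕ) → Fin n → Proof [A.pow n] A
  | 0, i => i.elim0
  | 1, _ => ax A
  | n + 2, ⟨0, _⟩ => left (.ampL0 A (A.pow (n + 1))) [] [] (ax A)
  | n + 2, ⟨i + 1, hi⟩ => left (.ampL1 A (A.pow (n + 1))) [] []
      (projProof A (n + 1) ⟨i, Nat.lt_of_succ_lt_succ hi⟩)

/-- The `n`-boolean `i`, as a proof of `⊢ Aⁿ ⊸ A`. -/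
def boolProof (A : Formula α) (n : ℕ) (i : Fin n) : Proof [] (nbool n A) :=
  limpR (projProof A n i)

/-- The formula `(!ₛbool)^{⊗N} ⊗ !ₙbool`. -/
def confType (s n : ℕ) (A : Formula α) (N : ℕ) : Formula α :=
  tensorBangs (List.replicate N (nbool s A)) (nbool n A)

/-- A word of length `N` over `{0, …, s-1}` and a state in `{0, …, n-1}`, as a proof of
`⊢ (!ₛbool)^{⊗N} ⊗ !ₙbool`: the tensor product of the promotions of the booleans. -/
def confProof (s n : ℕ) (A : Formula α) (q : Fin n) :
    (N : ℕ) → (Fin N → Fin s) → Proof [] (confType s n A N)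
  | 0, _ => prom (Γ := []) (boolProof A n q)
  | N + 1, t =>
    tensorR (prom (Γ := []) (boolProof A s (t 0))) (confProof s n A q N (fun j => t j.succ))

end Sequents

/-! ### Turing machines -/

/-- A configuration of a Turing machine with tape alphabet `{0, …, s-1}`, states `{0, …, n-1}` and a
tape that is unbounded in both directions. -/
structure Config (s n : ℕ) where
  tape : ℤ → Fin s
  head : ℤ
  state : Fin n

/-- One step of the Turing machine with transition function `δ`: write, change state, move. -/
def Config.step {s n : ℕ} (δ : Fin s × Fin n → Fin s × Fin n × Turing.Dir) (c : Config s n) :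
    Config s n :=
  let r := δ (c.tape c.head, c.state)
  { tape := Function.update c.tape c.head r.1
    head := match r.2.2 with
      | .left => c.head - 1
      | .right => c.head + 1
    state := r.2.1 }

/-- The tape squares in positions `-h, …, h` relative to the head. -/
def Config.window {s n : ℕ} (c : Config s n) (h : ℕ) : Fin (2 * h + 1) → Fin s :=
  fun j => c.tape (c.head + ((j : ℤ) - h))

/-! ### The Sweedler semantics -/

noncomputable section Semantics

variable {α : Type w} {k : Type u} [Field k] (v : α → ModuleCat.{u} k)

open Formula

/-- The denotation of a formula, given the denotations of the atoms. -/
def den : Formula α → ModuleCat.{u} k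
  | .atom x => v x
  | .tensor A B => ModuleCat.of k (den A ⊗[k] den B)
  | .amp A B => ModuleCat.of k (den A × den B)
  | .limp A B => ModuleCat.of k (den A →ₗ[k] den B)
  | .bang A => ModuleCat.of k (Bang k (den A))

/-- The denotation `⟦A₁⟧ ⊗ (⟦A₂⟧ ⊗ ⋯ ⊗ k)` of a context. -/
def denCtx : List (Formula α) → ModuleCat.{u} k
  | [] => ModuleCat.of k k
  | A :: Γ => ModuleCat.of k (den v A ⊗[k] denCtx Γ)

/-- `!⟦A₁⟧ ⊗ ⋯ ⊗ !⟦A_r⟧` is a coalgebra. -/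
instance instCoalgebraCtx : (Γ : List (Formula α)) → Coalgebra k (denCtx v (Γ.map bang))
  | [] => inferInstanceAs (Coalgebra k k)
  | A :: Γ =>
    letI := instCoalgebraCtx Γ
    inferInstanceAs (Coalgebra k (Bang k (den v A) ⊗[k] denCtx v (Γ.map bang)))

instance instIsCocommCtx : (Γ : List (Formula α)) →
    Coalgebra.IsCocomm k (denCtx v (Γ.map bang))
  | [] => inferInstanceAs (Coalgebra.IsCocomm k k)
  | A :: Γ =>
    letI := instIsCocommCtx Γ
    inferInstanceAs (Coalgebra.IsCocomm k (Bang k (den v A) ⊗[k] denCtx v (Γ.map bang)))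

/-- `⟦Γ, Δ⟧ ≅ ⟦Γ⟧ ⊗ ⟦Δ⟧`. -/
def appendIso : (Γ Δ : List (Formula α)) →
    (denCtx v (Γ ++ Δ) ≃ₗ[k] denCtx v Γ ⊗[k] denCtx v Δ)
  | [], Δ => (TensorProduct.lid k (denCtx v Δ)).symm
  | A :: Γ, Δ =>
    (TensorProduct.congr (LinearEquiv.refl k (den v A)) (appendIso Γ Δ)).trans
      (TensorProduct.assoc k (den v A) (denCtx v Γ) (denCtx v Δ)).symm

/-- A linear map `⟦Γ⟧ → ⟦Γ'⟧` applied inside a larger context. -/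
def inCtx {Γ Γ' : List (Formula α)} (f : denCtx v Γ →ₗ[k] denCtx v Γ') :
    (Δ₁ Δ₂ : List (Formula α)) →
    (denCtx v (Δ₁ ++ (Γ ++ Δ₂)) →ₗ[k] denCtx v (Δ₁ ++ (Γ' ++ Δ₂)))
  | [], Δ₂ => (appendIso v Γ' Δ₂).symm.toLinearMap ∘ₗ f.rTensor (denCtx v Δ₂) ∘ₗ
      (appendIso v Γ Δ₂).toLinearMap
  | A :: Δ₁, Δ₂ => (inCtx f Δ₁ Δ₂).lTensor (den v A)

/-- The denotation of a left rule, as a map from the conclusion block to the premise block. -/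
def LRule.den {Θ Θ' : List (Formula α)} : LRule Θ Θ' → (denCtx v Θ' →ₗ[k] denCtx v Θ)
  | .exch A B => (TensorProduct.leftComm k (SweedlerLL.den v B) (SweedlerLL.den v A) k).toLinearMap
  | .tensorL A B =>
    (TensorProduct.assoc k (SweedlerLL.den v A) (SweedlerLL.den v B) k).toLinearMap
  | .ampL0 A B => (LinearMap.fst k (SweedlerLL.den v A) (SweedlerLL.den v B)).rTensor k
  | .ampL1 A B => (LinearMap.snd k (SweedlerLL.den v A) (SweedlerLL.den v B)).rTensor k
  | .der A => (bangD k (SweedlerLL.den v A)).rTensor k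
  | .wk A => (TensorProduct.lid k k).toLinearMap ∘ₗ
      (Coalgebra.counit (R := k) (A := Bang k (SweedlerLL.den v A))).rTensor k
  | .ctr A =>
    (TensorProduct.assoc k (Bang k (SweedlerLL.den v A)) (Bang k (SweedlerLL.den v A)) k).toLinearMap
      ∘ₗ (Coalgebra.comul (R := k) (A := Bang k (SweedlerLL.den v A))).rTensor k

/-- A linear map to `⟦A⟧` as a map to the denotation of the one-formula context. -/
def toCtx {M : Type u} [AddCommGroup M] [Module k M] {A : Formula α} (f : M →ₗ[k] den v A) :
    M →ₗ[k] denCtx v [A] :=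
  (TensorProduct.rid k (den v A)).symm.toLinearMap ∘ₗ f

/-- Evaluation `⟦A, A ⊸ B⟧ → ⟦B⟧`. -/
def evalCtx (A B : Formula α) : denCtx v [A, limp A B] →ₗ[k] denCtx v [B] :=
  toCtx v (A := B) (TensorProduct.lift LinearMap.applyₗ ∘ₗ
    ((TensorProduct.rid k (den v A →ₗ[k] den v B)).toLinearMap.lTensor (den v A)))

/-- The denotation `⟦p⟧ : ⟦Γ⟧ → ⟦A⟧` of a proof `p` of `Γ ⊢ A`. -/
def Proof.den : {Γ : List (Formula α)} → {A : Formula α} → Proof Γ A →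
    (denCtx v Γ →ₗ[k] SweedlerLL.den v A)
  | _, _, .ax A => (TensorProduct.rid k (SweedlerLL.den v A)).toLinearMap
  | _, _, .cut Δ₁ Δ₂ p q => q.den ∘ₗ inCtx v (toCtx v p.den) Δ₁ Δ₂
  | _, _, .left r Δ₁ Δ₂ p => p.den ∘ₗ inCtx v (r.den v) Δ₁ Δ₂
  | _, _, .tensorR (Γ := Γ) (Δ := Δ) p q =>
    TensorProduct.map p.den q.den ∘ₗ (appendIso v Γ Δ).toLinearMap
  | _, _, .limpR (Γ := Γ) (A := A) p =>
    TensorProduct.curry (p.den ∘ₗ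
      (TensorProduct.comm k (denCtx v Γ) (SweedlerLL.den v A)).toLinearMap)
  | _, _, .limpL (A := A) (B := B) Δ₁ Δ₂ p q =>
    q.den ∘ₗ inCtx v (evalCtx v A B) Δ₁ Δ₂ ∘ₗ inCtx v (toCtx v p.den) Δ₁ (limp A B :: Δ₂)
  | _, _, .ampR p q => LinearMap.prod p.den q.den
  | _, _, .prom (Γ := Γ) (A := A) p =>
    (bangLift (V := SweedlerLL.den v A) (C := denCtx v (Γ.map bang)) p.den).toLinearMap

/-- The element of `⟦A⟧` denoted by a proof of `⊢ A`. -/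
def Proof.val {A : Formula α} (p : Proof [] A) : SweedlerLL.den v A :=
  p.den v (1 : k)

/-- The denotation `⟦A⟧ → ⟦B⟧` of a proof of `A ⊢ B`. -/
def Proof.map {A B : Formula α} (p : Proof [A] B) : SweedlerLL.den v A →ₗ[k] SweedlerLL.den v B :=
  p.den v ∘ₗ (TensorProduct.rid k (SweedlerLL.den v A)).symm.toLinearMap

/-- The vector `∑ᵢ xᵢ ⟦i⟧` of `⟦ₙbool⟧`. -/
def boolVec (A : Formula α) {n : ℕ} (x : Fin n → k) : den v (nbool n A) :=
  ∑ i, x i • (boolProof A n i).val v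

/-- The vector `|∅⟩_{θ₀} ⊗ ⋯ ⊗ |∅⟩_{θ_{N-1}} ⊗ |∅⟩_μ` of `⟦(!ₛbool)^{⊗N} ⊗ !ₙbool⟧`. -/
def vacConf (s n : ℕ) (A : Formula α) (μ : den v (nbool n A)) :
    (N : ℕ) → (Fin N → den v (nbool s A)) → den v (confType s n A N)
  | 0, _ => vacuum μ
  | N + 1, θ => vacuum (θ 0) ⊗ₜ[k] vacConf s n A μ N (fun j => θ j.succ)

section RelativeStep

variable {s n : ℕ} [NeZero s] (A : Formula α)
  (δ : Fin s × Fin n → Fin s × Fin n × Turing.Dir) (h : ℕ) (a : ℤ → Fin s → k) (b : Fin n → k)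

/-- The vector that describes the square in position `p` relative to the old head position after
the new symbol is written: the written symbol for `p = 0`, the vector `∑ᵢ a^p_i ⟦i⟧` of the input
for `0 < |p| ≤ h`, and the blank symbol `⟦0⟧` for `|p| > h`. -/
def cellVec (p : ℤ) : den v (nbool s A) :=
  if p = 0 then ∑ i, ∑ q, (a 0 i * b q) • (boolProof A s (δ (i, q)).1).val v
  else if |p| ≤ h then boolVec v A (a p)
  else (boolProof A s 0).val v

/-- The sum of the coefficients of the input vectors used by `cellVec`. -/
def cellMass (p : ℤ) : k :=
  if p = 0 then (∑ i, a 0 i) * ∑ q, b q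
  else if |p| ≤ h then ∑ i, a p i
  else 1

/-- The coefficient `∑_{i, q} a^0_i b_q`, over the pairs `(i, q)` for which the head moves in
direction `d`. -/
def dirMass (d : Turing.Dir) : k :=
  ∑ i, ∑ q, if (δ (i, q)).2.2 = d then a 0 i * b q else 0

/-- The vector `θ^m` for the square in position `m` relative to the new head position. -/
def relTheta (m : ℤ) : den v (nbool s A) :=
  (dirMass δ a b .left * cellMass h a b (m + 1)) • cellVec v A δ h a b (m - 1) +
    (dirMass δ a b .right * cellMass h a b (m - 1)) • cellVec v A δ h a b (m + 1)

/-- The vector `μ` for the new state. -/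
def relMu : den v (nbool n A) :=
  ∑ i, ∑ q, (a 0 i * b q) • (boolProof A n (δ (i, q)).2.1).val v

end RelativeStep

end Semantics

end SweedlerLL

-- Each square of the new tape, and the new state, is a function of finitely many input booleans.
-- Any such function is computed by a linear proof. In `Aᵐ, bool, …, bool ⊢ A`, the last boolean is
-- applied to the tuple of proofs for its possible values, recursively, with projections from `Aᵐ`
-- at the leaves (`tableProof`). With one hypothesis for each read, dereliction, contraction and
-- weakening turn this into a plain proof (`exists_isPlain_table`). `relstep` has one such proof per
-- component, so it is component-wise plain by construction.
--
-- Square `m` relative to the new head is square `m - 1` of the written tape after a move to the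
-- left, and square `m + 1` after a move to the right. Its table reads the scanned symbol and the
-- state to find the direction, and then both candidate squares. If a candidate is square `0`, the
-- scanned symbol and the state are read once more to find what was written.
--
-- Claims 2 and 3 have a common structural part. A cut of a promoted closed proof against
-- dereliction, weakening or contraction uses, discards or duplicates that proof. A vacuum vector is
-- group-like, so the universal map returns its base point, the counit gives `1`, and the
-- comultiplication duplicates it; a lift sends a group-like element to a vacuum vector
-- (`bangLift_groupLike`). `EvalModel` abstracts these rules, with instances `cutModel` and
-- `vecModel`, and reduces `relstep` to its linear tables once for both.
--
-- It remains to evaluate a table. On booleans it returns the entry (`cutEval_tableProof`). On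
-- linear combinations of booleans it expands multilinearly (`vecEval_tableProof`, with `tableSum`).
-- A variable that is read without influencing the result contributes the sum of its coefficients.
-- This is the source of the factors `w`, while the pairs that decide the direction sum to `D_left`
-- and `D_right` (`tableSum_symbolTable`).

universe x

namespace SweedlerLL

open Formula Proof

variable {α : Type w}

/-! ### Abstract evaluation of the structural rules, `⊗` and promotion. -/

/-- An evaluation of proofs on lists of inputs: `E p L y` says that `p` sends the inputs `L` to
`y`. The operations `pr` and `tn` interpret promotions and tensor products of values. -/
structure EvalModel (α : Type w) where
  /-- The values of a formula. -/
  D : Formula α → Type x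
  /-- The evaluation relation. -/
  E : {Γ : List (Formula α)} → {C : Formula α} → Proof Γ C → List (Sigma D) → D C → Prop
  /-- Promotion of values. -/
  pr : {A : Formula α} → D A → D (bang A)
  /-- Tensor product of values. -/
  tn : {A B : Formula α} → D A → D B → D (tensor A B)
  exch : ∀ {A B C : Formula α} {Δ₁ Δ₂ : List (Formula α)} {p : Proof (Δ₁ ++ ([A, B] ++ Δ₂)) C}
    {L₁ L₂ : List (Sigma D)} {a : D A} {b : D B} {y : D C}, Δ₁ = L₁.map Sigma.fst →
    Δ₂ = L₂.map Sigma.fst → E p (L₁ ++ ⟨A, a⟩ :: ⟨B, b⟩ :: L₂) y →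
    E (left (.exch A B) Δ₁ Δ₂ p) (L₁ ++ ⟨B, b⟩ :: ⟨A, a⟩ :: L₂) y
  tensorL : ∀ {A B C : Formula α} {Δ₁ Δ₂ : List (Formula α)}
    {p : Proof (Δ₁ ++ ([A, B] ++ Δ₂)) C}
    {L₁ L₂ : List (Sigma D)} {a : D A} {b : D B} {y : D C}, Δ₁ = L₁.map Sigma.fst →
    Δ₂ = L₂.map Sigma.fst → E p (L₁ ++ ⟨A, a⟩ :: ⟨B, b⟩ :: L₂) y →
    E (left (.tensorL A B) Δ₁ Δ₂ p) (L₁ ++ ⟨tensor A B, tn a b⟩ :: L₂) y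
  der : ∀ {A C : Formula α} {Δ₁ Δ₂ : List (Formula α)} {p : Proof (Δ₁ ++ ([A] ++ Δ₂)) C}
    {L₁ L₂ : List (Sigma D)} {a : D A} {y : D C}, Δ₁ = L₁.map Sigma.fst →
    Δ₂ = L₂.map Sigma.fst → E p (L₁ ++ ⟨A, a⟩ :: L₂) y →
    E (left (.der A) Δ₁ Δ₂ p) (L₁ ++ ⟨bang A, pr a⟩ :: L₂) y
  wk : ∀ {A C : Formula α} {Δ₁ Δ₂ : List (Formula α)} {p : Proof (Δ₁ ++ ([] ++ Δ₂)) C}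
    {L₁ L₂ : List (Sigma D)} {y : D C} (a : D A), Δ₁ = L₁.map Sigma.fst →
    Δ₂ = L₂.map Sigma.fst → E p (L₁ ++ L₂) y →
    E (left (.wk A) Δ₁ Δ₂ p) (L₁ ++ ⟨bang A, pr a⟩ :: L₂) y
  ctr : ∀ {A C : Formula α} {Δ₁ Δ₂ : List (Formula α)}
    {p : Proof (Δ₁ ++ ([bang A, bang A] ++ Δ₂)) C}
    {L₁ L₂ : List (Sigma D)} {a : D A} {y : D C}, Δ₁ = L₁.map Sigma.fst →
    Δ₂ = L₂.map Sigma.fst → E p (L₁ ++ ⟨bang A, pr a⟩ :: ⟨bang A, pr a⟩ :: L₂) y →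
    E (left (.ctr A) Δ₁ Δ₂ p) (L₁ ++ ⟨bang A, pr a⟩ :: L₂) y
  tensorR : ∀ {Γ Δ : List (Formula α)} {A B : Formula α} {p : Proof Γ A} {q : Proof Δ B}
    {L₁ L₂ : List (Sigma D)} {a : D A} {b : D B}, E p L₁ a → E q L₂ b →
    E (tensorR p q) (L₁ ++ L₂) (tn a b)
  prom : ∀ {Γ : List (Formula α)} {A : Formula α} {p : Proof (Γ.map bang) A}
    {L : List (Sigma D)} {a : D A}, Γ = L.map Sigma.fst →
    E p (L.map fun i => ⟨bang i.1, pr i.2⟩) a →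
    E (prom p) (L.map fun i => ⟨bang i.1, pr i.2⟩) (pr a)

namespace EvalModel

variable (M : EvalModel.{w, x} α) {C : Formula α} {y : M.D C}

/-- Promotion of an input. -/
def prI (i : Sigma M.D) : Sigma M.D := ⟨bang i.1, M.pr i.2⟩

theorem map_fst_map_prI (L : List (Sigma M.D)) :
    (L.map M.prI).map Sigma.fst = (L.map Sigma.fst).map bang := by
  simp [prI, Function.comp_def]

variable {M}

/-- Inputs are lists of `Sigma` pairs and are not indexed by the context, so transport of a proof
along an equality of contexts does not affect them. This is why the fields of `EvalModel` relate
contexts to inputs by equations. -/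
theorem E.recast {Γ Δ : List (Formula α)} {h : Γ = Δ} {p : Proof Γ C} {L L' : List (Sigma M.D)}
    (hp : M.E p L y) (hL : L = L') : M.E (recast h p) L' y := by
  subst h hL; exact hp

theorem E.moveLeft {B : Formula α} {b : M.D B} {L₂ : List (Sigma M.D)} :
    ∀ {K L₁ : List (Sigma M.D)} {Γ Δ₁ Δ₂ : List (Formula α)} {p : Proof (Δ₁ ++ (Γ ++ B :: Δ₂)) C},
    Γ = K.map Sigma.fst → Δ₁ = L₁.map Sigma.fst → Δ₂ = L₂.map Sigma.fst →
    M.E p (L₁ ++ (K ++ ⟨B, b⟩ :: L₂)) y →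
    M.E (moveLeft B Γ Δ₁ Δ₂ p) (L₁ ++ ⟨B, b⟩ :: (K ++ L₂)) y
  | [], _, _, _, _, _, hΓ, _, _, hp => by subst hΓ; exact hp
  | ⟨A, a⟩ :: K, L₁, _, Δ₁, Δ₂, p, hΓ, h1, h2, hp => by
    subst hΓ
    refine M.exch h1 (by simp [h2]) ?_
    refine E.recast (E.moveLeft (b := b) (L₁ := L₁ ++ [⟨A, a⟩]) rfl (by simp [h1]) h2
      (E.recast hp ?_)) ?_ <;> simp

theorem E.ctrList {L₂ : List (Sigma M.D)} :
    ∀ {K L₁ : List (Sigma M.D)} {Γ Δ₁ Δ₂ : List (Formula α)}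
    {p : Proof (Δ₁ ++ (Γ.map bang ++ (Γ.map bang ++ Δ₂))) C},
    Γ = K.map Sigma.fst → Δ₁ = L₁.map Sigma.fst → Δ₂ = L₂.map Sigma.fst →
    M.E p (L₁ ++ (K.map M.prI ++ (K.map M.prI ++ L₂))) y →
    M.E (ctrList Γ Δ₁ Δ₂ p) (L₁ ++ (K.map M.prI ++ L₂)) y
  | [], _, _, _, _, _, hΓ, _, _, hp => by subst hΓ; exact hp
  | ⟨A, a⟩ :: K, L₁, _, Δ₁, Δ₂, p, hΓ, h1, h2, hp => by
    subst hΓ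
    refine E.recast (E.ctrList (K := K) (L₁ := L₁ ++ [⟨bang A, M.pr a⟩]) rfl (by simp [h1]) h2
      (E.recast (M.ctr (a := a) (L₁ := L₁) (L₂ := K.map M.prI ++ (K.map M.prI ++ L₂))
        h1 ?_ (E.recast (E.moveLeft (L₁ := L₁ ++ [⟨bang A, M.pr a⟩]) (K := K.map M.prI)
          (b := M.pr a) (L₂ := K.map M.prI ++ L₂) ?_ ?_ ?_ (E.recast hp ?_)) ?_)) ?_)) ?_
    all_goals simp [prI, h1, h2, Function.comp_def]

theorem E.derList {L₂ : List (Sigma M.D)} :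
    ∀ {K L₁ : List (Sigma M.D)} {Γ Δ₁ Δ₂ : List (Formula α)}
    {p : Proof (Δ₁ ++ (Γ ++ Δ₂)) C},
    Γ = K.map Sigma.fst → Δ₁ = L₁.map Sigma.fst → Δ₂ = L₂.map Sigma.fst →
    M.E p (L₁ ++ (K ++ L₂)) y → M.E (derList Γ Δ₁ Δ₂ p) (L₁ ++ (K.map M.prI ++ L₂)) y
  | [], _, _, _, _, _, hΓ, _, _, hp => by subst hΓ; exact hp
  | ⟨A, a⟩ :: K, L₁, _, Δ₁, Δ₂, p, hΓ, h1, h2, hp => by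
    subst hΓ
    refine E.recast (E.derList (K := K) (L₁ := L₁ ++ [⟨bang A, M.pr a⟩]) rfl (by simp [h1]) h2
      (E.recast (M.der (a := a) (L₁ := L₁) (L₂ := K ++ L₂) h1 ?_ hp) ?_)) ?_
    all_goals simp [prI, h2]

theorem E.collapse {A : Formula α} {a : M.D A} {L₁ L₂ : List (Sigma M.D)}
    {Δ₁ Δ₂ : List (Formula α)} (h1 : Δ₁ = L₁.map Sigma.fst) (h2 : Δ₂ = L₂.map Sigma.fst) :
    ∀ {n : ℕ} {p : Proof (Δ₁ ++ (List.replicate n (bang A) ++ Δ₂)) C},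
    M.E p (L₁ ++ (List.replicate n ⟨bang A, M.pr a⟩ ++ L₂)) y →
    M.E (collapse A n Δ₁ Δ₂ p) (L₁ ++ ⟨bang A, M.pr a⟩ :: L₂) y
  | 0, _, hp => M.wk a h1 h2 hp
  | 1, _, hp => hp
  | n + 2, p, hp => E.collapse h1 h2 (n := n + 1) (M.ctr h1 (by simp [h2]) hp)

/-- The inputs with multiplicities `d`. -/
def multEnv {D : Formula α → Type x} :
    (L : List (Sigma D)) → (Fin (L.map Sigma.fst).length → ℕ) → List (Sigma D)
  | [], _ => []
  | i :: L, d => List.replicate (d ⟨0, Nat.succ_pos _⟩) i ++ multEnv L (fun j => d j.succ)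

theorem map_fst_multEnv {D : Formula α → Type x} : (L : List (Sigma D)) →
    (d : Fin (L.map Sigma.fst).length → ℕ) →
    (multEnv L d).map Sigma.fst = multCtx id (L.map Sigma.fst) d
  | [], _ => rfl
  | i :: L, d => by
    simp only [multEnv, List.map_append, List.map_replicate, map_fst_multEnv L]
    rfl

theorem E.collapseList :
    ∀ {K L₁ : List (Sigma M.D)} {Δ₁ : List (Formula α)} {d : Fin (K.map Sigma.fst).length → ℕ}
    {p : Proof (Δ₁ ++ multCtx bang (K.map Sigma.fst) d) C},
    Δ₁ = L₁.map Sigma.fst → M.E p (L₁ ++ (multEnv K d).map M.prI) y →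
    M.E (collapseList (K.map Sigma.fst) d Δ₁ p) (L₁ ++ K.map M.prI) y
  | [], _, _, _, _, _, hp => hp
  | ⟨A, a⟩ :: K, L₁, Δ₁, d, p, h1, hp => by
    refine E.recast (E.collapseList (K := K) (L₁ := L₁ ++ [⟨bang A, M.pr a⟩])
      (by simp [h1]) (E.recast (E.collapse (a := a) (L₁ := L₁)
        (L₂ := (multEnv K fun j => d j.succ).map M.prI) h1 ?_ (E.recast (h := rfl) hp ?_)) ?_)) ?_
    · rw [map_fst_map_prI, map_fst_multEnv, map_multCtx]
    all_goals simp [prI, multEnv]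

/-- On promoted inputs, derelictions recover the values, and contractions and weakenings only adjust
multiplicities. A plain proof is thereby reduced to its linear core on repeated, unpromoted inputs.
-/
theorem E.plainForm {K : List (Sigma M.D)} {d : Fin (K.map Sigma.fst).length → ℕ}
    {p : Proof (multCtx id (K.map Sigma.fst) d) C} (hp : M.E p (multEnv K d) y) :
    M.E (plainForm (K.map Sigma.fst) d p) (K.map M.prI) y :=
  E.collapseList (L₁ := []) rfl (E.recast (E.derList (L₁ := []) (L₂ := [])
    (map_fst_multEnv K d).symm rfl rfl (E.recast hp (by simp))) (by simp))

/-- The tensor product of the promotions of `t 0, …, t (N - 1)` and `q`. -/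
def conf (M : EvalModel.{w, x} α) {X Y : Formula α} (q : M.D Y) :
    (N : ℕ) → (Fin N → M.D X) → M.D (tensorBangs (List.replicate N X) Y)
  | 0, _ => M.pr q
  | N + 1, t => M.tn (M.pr (t 0)) (conf M q N fun j => t j.succ)

/-- `m + 1` copies of a list of inputs. -/
def copiesEnv {T : Type*} (L : List T) : ℕ → List T
  | 0 => L
  | m + 1 => L ++ copiesEnv L m

theorem E.ctrCopies {K : List (Sigma M.D)} :
    ∀ {m : ℕ} {L₁ : List (Sigma M.D)} {Δ₁ : List (Formula α)}
    {p : Proof (Δ₁ ++ copies ((K.map Sigma.fst).map bang) m) C},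
    Δ₁ = L₁.map Sigma.fst → M.E p (L₁ ++ copiesEnv (K.map M.prI) m) y →
    M.E (ctrCopies (K.map Sigma.fst) m Δ₁ p) (L₁ ++ K.map M.prI) y
  | 0, _, _, _, _, hp => hp
  | m + 1, L₁, Δ₁, p, h1, hp => by
    refine E.recast (E.ctrList (K := K) (L₁ := L₁) (L₂ := []) rfl h1 rfl
      (E.recast (E.ctrCopies (K := K) (L₁ := L₁ ++ K.map M.prI) ?_ (E.recast hp ?_)) ?_)) ?_
    · rw [List.map_append, map_fst_map_prI, h1]
    all_goals simp [copiesEnv]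

end EvalModel

/-- A family of proofs of `Γ ⊢ X`, as a family indexed by the entries of the list of `N` copies
of `X`. -/
def replFam {Γ : List (Formula α)} {X : Formula α} : (N : ℕ) → (Fin N → Proof Γ X) →
    ∀ i : Fin (List.replicate N X).length, Proof Γ ((List.replicate N X).get i)
  | 0, _ => fun i => i.elim0
  | N + 1, g => Fin.cases (g 0) (replFam N fun j => g j.succ)

theorem isPlain_replFam {As : List (Formula α)} {X : Formula α} : (N : ℕ) →
    (g : Fin N → Proof (As.map bang) X) → (∀ j, IsPlain As (g j)) →
    ∀ i, IsPlain As (replFam N g i)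
  | 0, _, _ => fun i => i.elim0
  | N + 1, g, h => by
    intro i
    refine Fin.cases ?_ (fun i => ?_) i
    · exact h 0
    · exact isPlain_replFam N _ (fun j => h j.succ) i

namespace EvalModel

variable {M : EvalModel.{w, x} α} {C : Formula α} {y : M.D C}

/-- Every component receives its own copy of the promoted inputs. The recursion of `replFam` runs
parallel to that of `tensorProms`, so the components reduce definitionally and no transport along
`(List.replicate N X).get i = X` is needed. -/
theorem E.tensorProms {K : List (Sigma M.D)} {X Y : Formula α}
    {χ : Proof ((K.map Sigma.fst).map bang) Y} {q : M.D Y} (hχ : M.E χ (K.map M.prI) q) :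
    ∀ {N : ℕ} {g : Fin N → Proof ((K.map Sigma.fst).map bang) X} {t : Fin N → M.D X},
    (∀ j, M.E (g j) (K.map M.prI) (t j)) →
    M.E (tensorProms (K.map Sigma.fst) (List.replicate N X) (replFam N g) χ)
      (copiesEnv (K.map M.prI) (List.replicate N X).length) (M.conf q N t)
  | 0, _, _, _ => M.prom rfl hχ
  | _ + 1, _, _, h => M.tensorR (M.prom rfl (h 0)) (E.tensorProms hχ fun j => h j.succ)

theorem E.ofComponents {K : List (Sigma M.D)} {X Y : Formula α}
    {χ : Proof ((K.map Sigma.fst).map bang) Y} {q : M.D Y} (hχ : M.E χ (K.map M.prI) q)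
    {N : ℕ} {g : Fin N → Proof ((K.map Sigma.fst).map bang) X} {t : Fin N → M.D X}
    (h : ∀ j, M.E (g j) (K.map M.prI) (t j)) :
    M.E (ofComponents (K.map Sigma.fst) (List.replicate N X) (replFam N g) χ)
      (K.map M.prI) (M.conf q N t) :=
  E.ctrCopies (L₁ := []) rfl (E.tensorProms hχ h)

theorem E.tensorLList {X Y : Formula α} {q : M.D Y} :
    ∀ {N : ℕ} {t : Fin N → M.D X} {L₁ : List (Sigma M.D)} {Δ₁ : List (Formula α)}
    {p : Proof (Δ₁ ++ (List.replicate N X ++ [Y]).map bang) C},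
    Δ₁ = L₁.map Sigma.fst →
    M.E p (L₁ ++ ((List.ofFn fun j => (⟨X, t j⟩ : Sigma M.D)) ++
      [(⟨Y, q⟩ : Sigma M.D)]).map M.prI) y →
    M.E (tensorLList Y (List.replicate N X) Δ₁ p) (L₁ ++ [⟨_, M.conf q N t⟩]) y
  | 0, _, _, _, _, _, hp => hp
  | N + 1, t, L₁, Δ₁, p, h1, hp => by
    refine M.tensorL (a := M.pr (t 0)) (b := M.conf q N fun j => t j.succ) (L₂ := []) h1 rfl
      (E.recast (E.tensorLList (L₁ := L₁ ++ [⟨bang X, M.pr (t 0)⟩]) (t := fun j => t j.succ)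
        (q := q)
        (by simp [h1]) (E.recast hp ?_)) ?_)
    all_goals simp [prI, List.ofFn_succ]

end EvalModel

/-! ### Cuts against closed proofs. -/

section Cuts

theorem cutEq_recast {Γ Δ : List (Formula α)} {C : Formula α} (h : Γ = Δ) (p : Proof Γ C) :
    CutEq (recast h p) p := by
  subst h; exact .refl p

theorem CutEq.cut_congr {Γ Δ₁ Δ₂ Δ₁' Δ₂' : List (Formula α)} {A C : Formula α} {p p' : Proof Γ A}
    {q : Proof (Δ₁ ++ A :: Δ₂) C} {q' : Proof (Δ₁' ++ A :: Δ₂') C} (hp : CutEq p p')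
    (hq : CutEq q q') (h1 : Δ₁ = Δ₁') (h2 : Δ₂ = Δ₂') :
    CutEq (cut Δ₁ Δ₂ p q) (cut Δ₁' Δ₂' p' q') := by
  subst h1 h2; exact .congr_cut _ _ hp hq

theorem CutEq.prom_congr {Γ Γ' : List (Formula α)} {C : Formula α} {p : Proof (Γ.map bang) C}
    {p' : Proof (Γ'.map bang) C} (h : Γ = Γ') (hp : CutEq p p') : CutEq (prom p) (prom p') := by
  subst h; exact .congr_prom hp

/-- Closed proofs as inputs. -/
abbrev ClosedInput (α : Type w) : Type w := Σ A : Formula α, Proof [] A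

/-- Cuts of the closed proofs `L` against the block of hypotheses between `Δ₁` and `Δ₂`, the last
hypothesis first. -/
def closeAll {Γ : List (Formula α)} {C : Formula α} : (L : List (ClosedInput α)) →
    (Δ₁ Δ₂ : List (Formula α)) → (p : Proof Γ C) → Γ = Δ₁ ++ (L.map Sigma.fst ++ Δ₂) →
    Proof (Δ₁ ++ Δ₂) C
  | [], _, _, p, h => recast h p
  | ⟨A, a⟩ :: L, Δ₁, Δ₂, p, h =>
    cut Δ₁ Δ₂ a (recast (by simp) (closeAll L (Δ₁ ++ [A]) Δ₂ p (by simp [h])))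

variable {Γ Γ' Δ₁ Δ₂ Δ₃ Δ₁' Δ₂' : List (Formula α)} {A C : Formula α} {p : Proof Γ C}
  {p' : Proof Γ' C}

theorem CutEq.closeAll_congr {L : List (ClosedInput α)} {h : Γ = Δ₁ ++ (L.map Sigma.fst ++ Δ₂)}
    {h' : Γ' = Δ₁' ++ (L.map Sigma.fst ++ Δ₂')} (hp : CutEq p p') (h1 : Δ₁ = Δ₁') (h2 : Δ₂ = Δ₂') :
    CutEq (closeAll L Δ₁ Δ₂ p h) (closeAll L Δ₁' Δ₂' p' h') := by
  subst h1 h2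
  induction L generalizing Δ₁ with
  | nil => exact (cutEq_recast _ _).trans (hp.trans (cutEq_recast _ _).symm)
  | cons i L ih =>
    exact .congr_cut _ _ (.refl _) ((cutEq_recast _ _).trans (ih.trans (cutEq_recast _ _).symm))

theorem closeAll_cons {a : Proof [] A} {L : List (ClosedInput α)}
    {h : Γ = Δ₁ ++ ((⟨A, a⟩ :: L : List (ClosedInput α)).map Sigma.fst ++ Δ₂)}
    {q : Proof (Δ₁ ++ A :: Δ₂) C}
    (hq : CutEq (closeAll L (Δ₁ ++ [A]) Δ₂ p (by simp [h])) q) :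
    CutEq (closeAll (⟨A, a⟩ :: L) Δ₁ Δ₂ p h) (cut Δ₁ Δ₂ a q) :=
  .congr_cut _ _ (.refl _) ((cutEq_recast _ _).trans hq)

theorem closeAll_append {L₁ L₂ : List (ClosedInput α)}
    {h : Γ = Δ₁ ++ ((L₁ ++ L₂).map Sigma.fst ++ Δ₂)} :
    CutEq (closeAll (L₁ ++ L₂) Δ₁ Δ₂ p h)
      (closeAll L₁ Δ₁ Δ₂ (closeAll L₂ (Δ₁ ++ L₁.map Sigma.fst) Δ₂ p (by simp [h])) (by simp)) := by
  induction L₁ generalizing Δ₁ with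
  | nil => exact (CutEq.closeAll_congr (.refl _) (by simp) rfl).trans (cutEq_recast _ _).symm
  | cons i L₁ ih =>
    refine closeAll_cons ((ih (Δ₁ := Δ₁ ++ [i.1])).trans
      ((CutEq.closeAll_congr ?_ rfl rfl).trans (cutEq_recast _ _).symm))
    exact CutEq.closeAll_congr (.refl _) (by simp) rfl

/-- A closed cut to the left of a block passes through the cuts of the block one at a time by
`CutEq.cut_comm`; all other steps realign contexts. -/
theorem cut_closeAll_comm {a : Proof [] A} {L : List (ClosedInput α)}
    {h : Γ = (Δ₁ ++ A :: Δ₂) ++ (L.map Sigma.fst ++ Δ₃)} :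
    CutEq (cut Δ₁ (Δ₂ ++ Δ₃) a (recast (by simp) (closeAll L (Δ₁ ++ A :: Δ₂) Δ₃ p h)))
      (closeAll L (Δ₁ ++ Δ₂) Δ₃
        (cut Δ₁ (Δ₂ ++ (L.map Sigma.fst ++ Δ₃)) a (recast (by simp [h]) p)) (by simp)) := by
  induction L generalizing Δ₂ with
  | nil =>
    refine CutEq.trans (.congr_cut _ _ (.refl _) ?_) (cutEq_recast _ _).symm
    exact (cutEq_recast _ _).trans ((cutEq_recast _ _).trans (cutEq_recast _ _).symm)
  | cons i L ih =>
    obtain ⟨B, b⟩ := i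
    let r : Proof (Δ₁ ++ A :: (Δ₂ ++ B :: Δ₃)) C :=
      recast (by simp) (closeAll L (Δ₁ ++ A :: (Δ₂ ++ [B])) Δ₃ p (by simp [h]))
    refine CutEq.trans ?_ ((CutEq.cut_comm Δ₁ Δ₂ Δ₃ a b r).trans ?_)
    · refine .congr_cut _ _ (.refl _) ((cutEq_recast _ _).trans
        ((closeAll_cons (q := recast (by simp) r) ?_).trans (cutEq_recast _ _).symm))
      refine CutEq.trans ?_ (cutEq_recast _ _).symm
      refine CutEq.trans ?_ (cutEq_recast _ _).symm
      exact .closeAll_congr (.refl _) (by simp) rfl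
    · refine (closeAll_cons ?_).symm
      refine CutEq.trans ?_ (cutEq_recast _ _).symm
      refine CutEq.trans ?_ (CutEq.trans (ih (Δ₂ := Δ₂ ++ [B]) (h := by simp [h])).symm ?_)
      · refine .closeAll_congr (.cut_congr (.refl _) ?_ rfl (by simp)) (by simp) rfl
        exact (cutEq_recast _ _).trans (cutEq_recast _ _).symm
      · refine .cut_congr (.refl _) ?_ rfl (by simp)
        exact (cutEq_recast _ _).trans (cutEq_recast _ _).symm

theorem closeAll_comm {M L : List (ClosedInput α)}
    {h : Γ = (Δ₁ ++ (M.map Sigma.fst ++ Δ₂)) ++ (L.map Sigma.fst ++ Δ₃)} :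
    CutEq (closeAll M Δ₁ (Δ₂ ++ Δ₃) (closeAll L (Δ₁ ++ (M.map Sigma.fst ++ Δ₂)) Δ₃ p h) (by simp))
      (closeAll L (Δ₁ ++ Δ₂) Δ₃
        (closeAll M Δ₁ (Δ₂ ++ (L.map Sigma.fst ++ Δ₃)) p (by simp [h])) (by simp)) := by
  induction M generalizing Δ₁ with
  | nil =>
    exact (cutEq_recast _ _).trans (.closeAll_congr (cutEq_recast _ _).symm rfl rfl)
  | cons i M ih =>
    obtain ⟨A, a⟩ := i
    have h' : Γ = (Δ₁ ++ [A] ++ (M.map Sigma.fst ++ Δ₂)) ++ (L.map Sigma.fst ++ Δ₃) := by simp [h]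
    let r := closeAll M (Δ₁ ++ [A]) (Δ₂ ++ (L.map Sigma.fst ++ Δ₃)) p (by simp [h])
    refine (closeAll_cons (q := recast (by simp)
      (closeAll L (Δ₁ ++ A :: Δ₂) Δ₃ r (by simp))) ?_).trans
      (cut_closeAll_comm.trans (.closeAll_congr ?_ rfl rfl))
    · refine CutEq.trans ?_ (CutEq.trans (ih (h := h')) ?_)
      · exact .closeAll_congr (.closeAll_congr (.refl _) (by simp) rfl) rfl rfl
      · exact (CutEq.closeAll_congr (.refl _) (by simp) rfl).trans (cutEq_recast _ _).symm
    · exact .congr_cut _ _ (.refl _) ((cutEq_recast _ _).trans (cutEq_recast _ _).symm)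

/-- Closed cuts on disjoint blocks of hypotheses commute, so any block may be cut first. A left rule
acts on one block in the middle of the context, so its evaluation can be checked with just that
block closed. -/
theorem closeAll_middle {L₁ M L₂ : List (ClosedInput α)}
    {h : Γ = [] ++ ((L₁ ++ (M ++ L₂)).map Sigma.fst ++ [])} :
    CutEq (closeAll (L₁ ++ (M ++ L₂)) [] [] p h)
      (closeAll (L₁ ++ L₂) [] []
        (closeAll M (L₁.map Sigma.fst) (L₂.map Sigma.fst) p (by simp [h])) (by simp)) := by
  refine closeAll_append.trans (CutEq.trans (.closeAll_congr ?_ rfl rfl) closeAll_append.symm)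
  refine closeAll_append.trans ?_
  refine CutEq.trans (.closeAll_congr (.closeAll_congr (.refl _) ?_ rfl) rfl rfl)
    ((closeAll_comm (Δ₂ := []) (Δ₃ := []) (h := by simp [h])).trans
      (.closeAll_congr (.closeAll_congr (.refl _) rfl ?_) ?_ rfl))
  all_goals simp

theorem closeAll_congr_middle {L₁ M M' L₂ : List (ClosedInput α)}
    {h : Γ = [] ++ ((L₁ ++ (M ++ L₂)).map Sigma.fst ++ [])}
    {h' : Γ' = [] ++ ((L₁ ++ (M' ++ L₂)).map Sigma.fst ++ [])}
    (hp : CutEq (closeAll M (L₁.map Sigma.fst) (L₂.map Sigma.fst) p (by simp [h]))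
      (closeAll M' (L₁.map Sigma.fst) (L₂.map Sigma.fst) p' (by simp [h']))) :
    CutEq (closeAll (L₁ ++ (M ++ L₂)) [] [] p h) (closeAll (L₁ ++ (M' ++ L₂)) [] [] p' h') :=
  closeAll_middle.trans (CutEq.trans (.closeAll_congr hp rfl rfl) closeAll_middle.symm)

theorem CutEq.tensorR_congr {Δ Δ' : List (Formula α)} {A B : Formula α} {p : Proof Γ A}
    {p' : Proof Γ' A} {q : Proof Δ B} {q' : Proof Δ' B} (h : Γ = Γ') (h' : Δ = Δ')
    (hp : CutEq p p') (hq : CutEq q q') : CutEq (tensorR p q) (tensorR p' q') := by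
  subst h h'; exact .congr_tensorR hp hq

theorem closeAll_tensorR_right {Δ : List (Formula α)} {B : Formula α} {p : Proof Δ C}
    {q : Proof Γ B} {L : List (ClosedInput α)} {h : Γ = Δ₁ ++ (L.map Sigma.fst ++ Δ₂)} :
    CutEq (closeAll L (Δ ++ Δ₁) Δ₂ (tensorR p q) (by simp [h]))
      (tensorR p (closeAll L Δ₁ Δ₂ q h)) := by
  induction L generalizing Δ₁ with
  | nil =>
    exact (cutEq_recast _ _).trans (.tensorR_congr rfl h (.refl _) (cutEq_recast _ _).symm)
  | cons i L ih =>
    obtain ⟨A, a⟩ := i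
    refine CutEq.trans (closeAll_cons ?_) (CutEq.cut_tensorR_right Δ₁ Δ₂ a p _)
    refine CutEq.trans (CutEq.trans (.closeAll_congr (.refl _) (by simp) rfl)
      ((ih (Δ₁ := Δ₁ ++ [A]) (h := by simp [h])).trans ?_)) (cutEq_recast _ _).symm
    exact .tensorR_congr rfl (by simp) (.refl _) (cutEq_recast _ _).symm

theorem closeAll_tensorR_left {Δ : List (Formula α)} {B : Formula α} {p : Proof Γ C}
    {q : Proof Δ B} {L : List (ClosedInput α)} {h : Γ = Δ₁ ++ (L.map Sigma.fst ++ Δ₂)} :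
    CutEq (closeAll L Δ₁ (Δ₂ ++ Δ) (tensorR p q) (by simp [h]))
      (tensorR (closeAll L Δ₁ Δ₂ p h) q) := by
  induction L generalizing Δ₁ with
  | nil =>
    exact (cutEq_recast _ _).trans (.tensorR_congr h rfl (cutEq_recast _ _).symm (.refl _))
  | cons i L ih =>
    obtain ⟨A, a⟩ := i
    refine CutEq.trans (closeAll_cons ?_) (CutEq.cut_tensorR_left Δ₁ Δ₂ a _ q)
    refine CutEq.trans ((ih (Δ₁ := Δ₁ ++ [A]) (h := by simp [h])).trans ?_) (cutEq_recast _ _).symm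
    exact .tensorR_congr (by simp) rfl (cutEq_recast _ _).symm (.refl _)

theorem CutEq.limpR_congr {A B : Formula α} {p : Proof (A :: Γ) B} {p' : Proof (A :: Γ') B}
    (h : Γ = Γ') (hp : CutEq p p') : CutEq (limpR p) (limpR p') := by
  subst h; exact .congr_limpR hp

theorem closeAll_limpR {B : Formula α} {p : Proof (B :: Γ) C}
    {L : List (ClosedInput α)} {h : Γ = Δ₁ ++ (L.map Sigma.fst ++ Δ₂)} :
    CutEq (closeAll L Δ₁ Δ₂ (limpR p) h)
      (limpR (closeAll L (B :: Δ₁) Δ₂ p (by simp [h]))) := by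
  induction L generalizing Δ₁ with
  | nil =>
    subst h; exact .refl _
  | cons i L ih =>
    obtain ⟨A, a⟩ := i
    refine CutEq.trans (closeAll_cons ?_) (CutEq.cut_limpR Δ₁ Δ₂ a (recast (by simp)
      (closeAll L (B :: (Δ₁ ++ [A])) Δ₂ p (by simp [h]))))
    refine (ih (Δ₁ := Δ₁ ++ [A]) (h := by simp [h])).trans ?_
    exact .limpR_congr (by simp) (cutEq_recast _ _).symm

/-- The promotion of a closed input. -/
def promInput (i : ClosedInput α) : ClosedInput α := ⟨bang i.1, prom (Γ := []) i.2⟩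

/-- `CutEq.prom_prom` needs a promoted proof to be cut and a context of banged formulas. The inputs
are promotions of closed proofs, so each cut adds no hypotheses. Cutting the last hypothesis first
keeps the context to the right of the cut empty. -/
theorem closeAll_prom {G Θ : List (Formula α)} {p : Proof (G.map bang) C}
    {L : List (ClosedInput α)} (hG : G = Θ ++ L.map Sigma.fst)
    {h : G.map bang = Θ.map bang ++ ((L.map promInput).map Sigma.fst ++ [])} :
    CutEq (closeAll (L.map promInput) (Θ.map bang) [] (prom p) h)
      (prom (Γ := Θ) (recast (by simp) (closeAll (L.map promInput) (Θ.map bang) [] p h))) := by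
  induction L generalizing Θ with
  | nil =>
    exact (cutEq_recast _ _).trans (.prom_congr (by simpa using hG)
      ((cutEq_recast _ _).trans (cutEq_recast _ _)).symm)
  | cons i L ih =>
    obtain ⟨A, a⟩ := i
    have hG' : G = (Θ ++ [A]) ++ L.map Sigma.fst := by simp [hG]
    have h' : G.map bang = (Θ ++ [A]).map bang ++ ((L.map promInput).map Sigma.fst ++ []) := by
      simp [hG, promInput, Function.comp_def]
    let q : Proof ((Θ ++ A :: []).map bang) C :=
      recast (by simp) (closeAll (L.map promInput) ((Θ ++ [A]).map bang) [] p h')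
    refine CutEq.trans (closeAll_cons (q := recast (by simp) (prom q)) ?_)
      ((CutEq.prom_prom (Γ := []) Θ [] a q).trans (.prom_congr (by simp) ?_))
    · refine CutEq.trans ?_ (cutEq_recast _ _).symm
      exact (CutEq.closeAll_congr (.refl _) (by simp) rfl).trans (ih hG' (h := h'))
    · refine (cutEq_recast _ _).trans (CutEq.trans ?_ (cutEq_recast _ _).symm)
      refine (closeAll_cons ?_).symm
      refine CutEq.trans ?_ (cutEq_recast _ _).symm
      refine CutEq.trans ?_ (cutEq_recast _ _).symm
      exact .closeAll_congr (.refl _) (by simp) rfl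

theorem closeAll_one {a : Proof [] A} {p : Proof (Δ₁ ++ A :: Δ₂) C}
    {h : Δ₁ ++ A :: Δ₂ = Δ₁ ++ ([(⟨A, a⟩ : ClosedInput α)].map Sigma.fst ++ Δ₂)} :
    CutEq (closeAll [⟨A, a⟩] Δ₁ Δ₂ p h) (cut Δ₁ Δ₂ a p) :=
  closeAll_cons (cutEq_recast _ _)

theorem closeAll_two {B : Formula α} {a : Proof [] A} {b : Proof [] B}
    {p : Proof (Δ₁ ++ A :: B :: Δ₂) C}
    {h : Δ₁ ++ A :: B :: Δ₂ =
      Δ₁ ++ ([(⟨A, a⟩ : ClosedInput α), ⟨B, b⟩].map Sigma.fst ++ Δ₂)} :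
    CutEq (closeAll [⟨A, a⟩, ⟨B, b⟩] Δ₁ Δ₂ p h)
      (cut Δ₁ Δ₂ a (recast (by simp) (cut (Δ₁ ++ [A]) Δ₂ b (recast (by simp) p)))) := by
  refine closeAll_cons ?_
  refine CutEq.trans (closeAll_cons (q := recast (by simp) p) ?_) (cutEq_recast _ _).symm
  exact (cutEq_recast _ _).trans (cutEq_recast _ _).symm

/-- Evaluation by cuts: `p` sends closed proofs `L` to `y` if the cut of `L` against `p` is
equivalent to `y`. -/
def CutEval (p : Proof Γ C) (L : List (ClosedInput α)) (y : Proof [] C) : Prop :=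
  ∃ h : Γ = [] ++ (L.map Sigma.fst ++ []), CutEq (closeAll L [] [] p h) y

theorem CutEval.of_middle {L₁ M M' L₂ : List (ClosedInput α)} {y : Proof [] C}
    (hp : CutEval p (L₁ ++ (M ++ L₂)) y)
    (h' : Γ' = L₁.map Sigma.fst ++ (M'.map Sigma.fst ++ L₂.map Sigma.fst))
    (hM : ∀ h, CutEq (closeAll M' (L₁.map Sigma.fst) (L₂.map Sigma.fst) p' h')
      (closeAll M (L₁.map Sigma.fst) (L₂.map Sigma.fst) p h)) :
    CutEval p' (L₁ ++ (M' ++ L₂)) y :=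
  ⟨by simp [h'], (closeAll_congr_middle (hM _)).trans hp.2⟩

/-- Closed proofs as values, with evaluation by cuts. -/
def cutModel (α : Type w) : EvalModel.{w, w} α where
  D A := Proof [] A
  E := CutEval
  pr a := Proof.prom (Γ := []) a
  tn a b := Proof.tensorR a b
  exch {A B C Δ₁ Δ₂ p L₁ L₂ a b y} h1 h2 hp := by
    subst h1 h2
    refine CutEval.of_middle (M := [⟨A, a⟩, ⟨B, b⟩]) (M' := [⟨B, b⟩, ⟨A, a⟩]) hp rfl fun h => ?_
    refine closeAll_two.trans (CutEq.trans ?_ closeAll_two.symm)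
    -- As `a` is closed, the `moveLeft` produced by `CutEq.cut_exch_right` runs over an empty block
    -- and is the identity. The two cuts then only have to be interchanged.
    refine CutEq.trans (.congr_cut _ _ (.refl b) ((cutEq_recast _ _).trans
      (CutEq.trans (.congr_cut _ _ (.refl a) ?_) (CutEq.cut_exch_right _ _ a p)))) ?_
    · exact (cutEq_recast _ _).trans (cutEq_recast _ _).symm
    refine CutEq.trans (.cut_congr (.refl b) (cutEq_recast _ _).symm (by simp) rfl)
      (CutEq.cut_comm _ [] _ a b p).symm
  tensorL {A B C Δ₁ Δ₂ p L₁ L₂ a b y} h1 h2 hp := by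
    subst h1 h2
    refine CutEval.of_middle (M := [⟨A, a⟩, ⟨B, b⟩]) (M' := [⟨tensor A B, tensorR a b⟩])
      hp rfl fun h => ?_
    exact closeAll_one.trans ((CutEq.tensor_tensor _ _ a b p).trans closeAll_two.symm)
  der {A C Δ₁ Δ₂ p L₁ L₂ a y} h1 h2 hp := by
    subst h1 h2
    refine CutEval.of_middle (M := [⟨A, a⟩]) (M' := [⟨bang A, Proof.prom (Γ := []) a⟩])
      hp rfl fun h => ?_
    exact closeAll_one.trans ((CutEq.prom_der (Γ := []) _ _ a p).trans closeAll_one.symm)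
  wk {A C Δ₁ Δ₂ p L₁ L₂ y} a h1 h2 hp := by
    subst h1 h2
    refine CutEval.of_middle (M := []) (M' := [⟨bang A, Proof.prom (Γ := []) a⟩])
      hp rfl fun h => ?_
    -- The promoted proof has no hypotheses, so the `wkList` of this reduction is the identity; the
    -- same holds for `ctrList` in the contraction case.
    exact closeAll_one.trans ((CutEq.prom_wk (Γ := []) _ _ a p).trans (cutEq_recast _ _).symm)
  ctr {A C Δ₁ Δ₂ p L₁ L₂ a y} h1 h2 hp := by
    subst h1 h2
    refine CutEval.of_middle (M := [⟨bang A, Proof.prom (Γ := []) a⟩,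
      ⟨bang A, Proof.prom (Γ := []) a⟩]) (M' := [⟨bang A, Proof.prom (Γ := []) a⟩])
      hp rfl fun h => ?_
    exact closeAll_one.trans ((CutEq.prom_ctr (Γ := []) _ _ a p).trans closeAll_two.symm)
  tensorR {Γ Δ A B p q L₁ L₂ a b} hp hq := by
    obtain ⟨h1, hp⟩ := hp
    obtain ⟨h2, hq⟩ := hq
    refine ⟨by simp [h1, h2], closeAll_append.trans ?_⟩
    -- Once `L₂` is cut into the right premise, the context of the tensor is literally `Γ ++ ([] ++
    -- [])`; `L₁` is then cut into the left premise.
    have e : Γ ++ ([] ++ []) = [] ++ (L₁.map Sigma.fst ++ []) := by simp [h1]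
    refine CutEq.trans (.closeAll_congr (h' := e) (p' := Proof.tensorR p (closeAll L₂ [] [] q h2))
      (CutEq.trans (.closeAll_congr (.refl _) (by simp [h1]) rfl)
        (closeAll_tensorR_right (Δ := Γ) (Δ₁ := []) (h := h2))) rfl rfl) ?_
    exact (closeAll_tensorR_left (Δ₂ := []) (Δ := []) (h := h1)).trans (.congr_tensorR hp hq)
  prom {Γ A p L a} hΓ hp := by
    obtain ⟨h, hp⟩ := hp
    exact ⟨h, (closeAll_prom (Θ := []) (L := L) (by simpa using hΓ)).trans
      (.prom_congr rfl ((cutEq_recast _ _).trans hp))⟩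

end Cuts

/-! ### Group-like elements of the cofree coalgebra. -/

section GroupLike

variable {k : Type u} [Field k] {V : Type u} [AddCommGroup V] [Module k V]
variable {C : Type*} [AddCommGroup C] [Module k C] [Coalgebra k C]

theorem bangD_bangLift [Coalgebra.IsCocomm k C] (f : C →ₗ[k] V) (c : C) :
    bangD k V (bangLift f c) = f c :=
  (existsUnique_bangLift f).choose_spec.1 c

/-- The coalgebra morphism `k → C` that sends `1` to a group-like element. -/
def groupLikeHom {x : C} (hx : IsGroupLikeElem k x) : k →ₗc[k] C where
  toLinearMap := LinearMap.toSpanSingleton k C x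
  counit_comp := by ext; simp [hx.counit_eq_one]
  map_comp_comul := by ext; simp [hx.comul_eq_tmul_self]

/-- A lift sends a group-like element to the group-like element over its image. -/
theorem bangLift_groupLike [Coalgebra.IsCocomm k C] (f : C →ₗ[k] V) {x : C}
    (hx : IsGroupLikeElem k x) : bangLift f x = vacuum (f x) := by
  -- Both sides are coalgebra morphisms `k → !V` with the same composite with `d`, so the uniqueness
  -- half of the universal property identifies them. The claim is their equality at `1`.
  have h : (bangLift f).comp (groupLikeHom hx) =
      bangLift (LinearMap.toSpanSingleton k V (f x)) := by
    refine bang_hom_ext _ _ fun c => ?_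
    rw [bangD_bangLift]
    change bangD k V (bangLift f (c • x)) = _
    rw [bangD_bangLift]
    simp
  have h1 := congrArg (fun F => F (1 : k)) h
  refine Eq.trans ?_ h1
  change bangLift f x = bangLift f ((1 : k) • x)
  rw [one_smul]

theorem bangD_vacuum (P : V) : bangD k V (vacuum P) = P := by
  rw [vacuum, bangD_bangLift]; simp

/-- Coalgebra morphisms preserve group-like elements, and `1 : k` is one. This property makes
contraction duplicate a vacuum vector and weakening discard it with factor `1`. -/
theorem isGroupLikeElem_vacuum (P : V) : IsGroupLikeElem k (vacuum P : Bang k V) :=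
  IsGroupLikeElem.map (F := k →ₗc[k] Bang k V) (bangLift (LinearMap.toSpanSingleton k V P))
    (IsGroupLikeElem.one (R := k) (A := k))

theorem IsGroupLikeElem.tmul {C' : Type*} [AddCommGroup C'] [Module k C'] [Coalgebra k C']
    {x : C} {y : C'} (hx : IsGroupLikeElem k x) (hy : IsGroupLikeElem k y) :
    IsGroupLikeElem k (x ⊗ₜ[k] y) where
  counit_eq_one := by
    simp [hx.counit_eq_one, hy.counit_eq_one]
  comul_eq_tmul_self := by
    simp [TensorProduct.comul_tmul, hx.comul_eq_tmul_self, hy.comul_eq_tmul_self]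

end GroupLike

/-! ### Denotations on pure tensors. -/

noncomputable section

variable {k : Type u} [Field k] (v : α → ModuleCat.{u} k)

/-- Vectors as inputs. -/
abbrev VecInput : Type (max u w) := Σ A : Formula α, (den v A : Type u)

variable {v}

/-- The tensor product of the vectors `L` with a vector of `⟦Δ⟧`. -/
def tensorVecs {Δ : List (Formula α)} : (L : List (VecInput v)) → denCtx v Δ →
    denCtx v (L.map Sigma.fst ++ Δ)
  | [], z => z
  | i :: L, z => (i.2 ⊗ₜ[k] tensorVecs L z :
      den v i.1 ⊗[k] denCtx v (L.map Sigma.fst ++ Δ))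

/-- `x` is the tensor product of the vectors `L`. -/
inductive IsTensor : (Γ : List (Formula α)) → List (VecInput v) → denCtx v Γ → Prop
  | nil : IsTensor [] [] (1 : k)
  | cons {A : Formula α} {Γ : List (Formula α)} {L : List (VecInput v)} (a : den v A)
      {z : denCtx v Γ} : IsTensor Γ L z →
      IsTensor (A :: Γ) (⟨A, a⟩ :: L) (a ⊗ₜ[k] z : den v A ⊗[k] denCtx v Γ)

/-- The tensor of a list is determined by the list, so the existential in `VecEval` describes the
value of the denotation at one specific vector. -/
theorem IsTensor.eq {Γ : List (Formula α)} {L : List (VecInput v)} {x y : denCtx v Γ}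
    (hx : IsTensor Γ L x) (hy : IsTensor Γ L y) : x = y := by
  induction hx with
  | nil => cases hy; rfl
  | cons a _ ih => cases hy with | cons _ h => rw [ih h]

theorem IsTensor.of_eq {Γ : List (Formula α)} {L : List (VecInput v)} {x y : denCtx v Γ}
    (hx : IsTensor Γ L x) (h : y = x) : IsTensor Γ L y := h ▸ hx

theorem IsTensor.append {Δ : List (Formula α)} {M : List (VecInput v)} {z : denCtx v Δ}
    (hz : IsTensor Δ M z) : (L : List (VecInput v)) →
    IsTensor (L.map Sigma.fst ++ Δ) (L ++ M) (tensorVecs L z)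
  | [] => hz
  | i :: L => .cons i.2 (hz.append L)

theorem exists_isTensor : (L : List (VecInput v)) → ∃ x, IsTensor (L.map Sigma.fst) L x
  | [] => ⟨_, .nil⟩
  | i :: L => ⟨_, .cons i.2 (exists_isTensor L).choose_spec⟩

theorem inCtx_tensorVecs {Γ Γ' Δ : List (Formula α)} (f : denCtx v Γ →ₗ[k] denCtx v Γ') :
    (L : List (VecInput v)) → (z : denCtx v (Γ ++ Δ)) →
    inCtx v f (L.map Sigma.fst) Δ (tensorVecs L z) = tensorVecs L (inCtx v f [] Δ z)
  | [], _ => rfl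
  | i :: L, z => congrArg (fun t => (i.2 ⊗ₜ[k] t : den v i.1 ⊗[k] _)) (inCtx_tensorVecs f L z)

/-- Evaluation on vectors: the denotation of `p` sends the tensor product of `L` to `y`. -/
def VecEval {Γ : List (Formula α)} {C : Formula α} (p : Proof Γ C) (L : List (VecInput v))
    (y : den v C) : Prop :=
  ∃ x, IsTensor Γ L x ∧ p.den v x = y

theorem VecEval.den_eq {Γ : List (Formula α)} {C : Formula α} {p : Proof Γ C}
    {L : List (VecInput v)} {y : den v C} (h : VecEval p L y) {x : denCtx v Γ}
    (hx : IsTensor Γ L x) : p.den v x = y := by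
  obtain ⟨x', hx', h⟩ := h
  rw [hx.eq hx', h]

theorem appendIso_isTensor {Γ Δ : List (Formula α)} {L M : List (VecInput v)} {x : denCtx v Γ}
    {z : denCtx v Δ} (hx : IsTensor Γ L x) (hz : IsTensor Δ M z) :
    ∃ y, IsTensor (Γ ++ Δ) (L ++ M) y ∧ appendIso v Γ Δ y = x ⊗ₜ[k] z := by
  induction hx with
  | nil => exact ⟨z, hz, rfl⟩
  | cons a _ ih =>
    obtain ⟨y, hy, e⟩ := ih
    refine ⟨_, .cons a hy, ?_⟩
    exact congrArg (fun t => (TensorProduct.assoc k _ _ _).symm (a ⊗ₜ[k] t)) e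

theorem inCtx_isTensor {Γ Γ' Δ : List (Formula α)} {L L' M : List (VecInput v)}
    {f : denCtx v Γ →ₗ[k] denCtx v Γ'} {x : denCtx v Γ} {z : denCtx v Δ}
    (hx : IsTensor Γ L x) (hf : IsTensor Γ' L' (f x)) (hz : IsTensor Δ M z) :
    ∃ y, IsTensor (Γ ++ Δ) (L ++ M) y ∧ IsTensor (Γ' ++ Δ) (L' ++ M) (inCtx v f [] Δ y) := by
  obtain ⟨y, hy, e⟩ := appendIso_isTensor hx hz
  obtain ⟨y', hy', e'⟩ := appendIso_isTensor hf hz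
  refine ⟨y, hy, ?_⟩
  have : inCtx v f [] Δ y = y' := by
    simp only [inCtx, LinearMap.comp_apply, LinearEquiv.coe_coe, e]
    rw [LinearEquiv.symm_apply_eq, e']
    rfl
  rwa [this]

/-- The common form of all one-premise left rules: it suffices that the map of the rule sends the
pure tensor of the conclusion block to the pure tensor of the premise block, and the surrounding
inputs are carried along. -/
theorem VecEval.comp_inCtx {Γ Γ' Δ₁ Δ₂ : List (Formula α)} {C : Formula α}
    {L L' L₁ L₂ : List (VecInput v)} {f : denCtx v Γ →ₗ[k] denCtx v Γ'} {x : denCtx v Γ}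
    {y : den v C} {p : Proof (Δ₁ ++ (Γ' ++ Δ₂)) C} (h1 : Δ₁ = L₁.map Sigma.fst)
    (h2 : Δ₂ = L₂.map Sigma.fst) (hx : IsTensor Γ L x) (hf : IsTensor Γ' L' (f x))
    (hp : VecEval p (L₁ ++ (L' ++ L₂)) y) :
    ∃ z, IsTensor (Δ₁ ++ (Γ ++ Δ₂)) (L₁ ++ (L ++ L₂)) z ∧
      (p.den v ∘ₗ inCtx v f Δ₁ Δ₂) z = y := by
  subst h1 h2
  obtain ⟨z, hz⟩ := exists_isTensor L₂
  obtain ⟨t, ht, ht'⟩ := inCtx_isTensor hx hf hz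
  refine ⟨_, ht.append L₁, ?_⟩
  rw [LinearMap.comp_apply, inCtx_tensorVecs]
  exact hp.den_eq (ht'.append L₁)

/-- Promotion lifts a map out of the product coalgebra of the whole context. `bangLift_groupLike`
applies to it because a tensor of vacuum vectors is group-like there. -/
theorem isGroupLikeElem_isTensor : (L : List (VecInput v)) →
    {x : denCtx v ((L.map Sigma.fst).map bang)} →
    IsTensor ((L.map Sigma.fst).map bang)
      (L.map fun i : VecInput v => (⟨bang i.1, vacuum (V := den v i.1) i.2⟩ : VecInput v)) x →
    IsGroupLikeElem k x
  | [], _, h => by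
    cases h
    exact IsGroupLikeElem.one (R := k) (A := k)
  | i :: L, _, h => by
    cases h with
    | cons _ h =>
      have := IsGroupLikeElem.tmul (isGroupLikeElem_vacuum (V := den v i.1) i.2)
        (isGroupLikeElem_isTensor L h)
      exact this

variable (v) in
/-- Vectors as values, with evaluation by denotations. -/
def vecModel : EvalModel.{w, u} α where
  D A := den v A
  E := VecEval
  pr {A} a := (vacuum a : Bang k (den v A))
  tn {A B} a b := (a ⊗ₜ[k] b : den v A ⊗[k] den v B)
  exch {A B C Δ₁ Δ₂ p L₁ L₂ a b y} h1 h2 hp :=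
    VecEval.comp_inCtx (L := [⟨B, b⟩, ⟨A, a⟩]) (L' := [⟨A, a⟩, ⟨B, b⟩]) h1 h2
      (.cons b (.cons a .nil)) (.cons a (.cons b .nil)) hp
  tensorL {A B C Δ₁ Δ₂ p L₁ L₂ a b y} h1 h2 hp :=
    VecEval.comp_inCtx (f := LRule.den v (.tensorL A B))
      (L := [⟨tensor A B, (a ⊗ₜ[k] b : den v A ⊗[k] den v B)⟩])
      (L' := [⟨A, a⟩, ⟨B, b⟩]) h1 h2
      (.cons (A := tensor A B) _ .nil) (.cons a (.cons b .nil)) hp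
  der {A C Δ₁ Δ₂ p L₁ L₂ a y} h1 h2 hp := by
    refine VecEval.comp_inCtx (f := LRule.den v (.der A))
      (L := [⟨bang A, (vacuum a : Bang k (den v A))⟩])
      (L' := [⟨A, a⟩]) h1 h2 (.cons (A := bang A) _ .nil) ?_ hp
    exact IsTensor.of_eq (.cons a .nil) (congrArg (fun t => (t ⊗ₜ[k] (1 : k) : den v A ⊗[k] k))
      (bangD_vacuum (V := den v A) a))
  wk {A C Δ₁ Δ₂ p L₁ L₂ y} a h1 h2 hp := by
    refine VecEval.comp_inCtx (f := LRule.den v (.wk A))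
      (L := [⟨bang A, (vacuum a : Bang k (den v A))⟩])
      (L' := []) h1 h2 (.cons (A := bang A) _ .nil) ?_ hp
    refine IsTensor.of_eq .nil ?_
    change TensorProduct.lid k k
      (Coalgebra.counit (R := k) (vacuum a : Bang k (den v A)) ⊗ₜ[k] (1 : k)) = 1
    rw [(isGroupLikeElem_vacuum a).counit_eq_one]
    simp
  ctr {A C Δ₁ Δ₂ p L₁ L₂ a y} h1 h2 hp := by
    refine VecEval.comp_inCtx (f := LRule.den v (.ctr A))
      (L := [⟨bang A, (vacuum a : Bang k (den v A))⟩])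
      (L' := [⟨bang A, (vacuum a : Bang k (den v A))⟩, ⟨bang A, (vacuum a : Bang k (den v A))⟩])
      h1 h2 (.cons (A := bang A) _ .nil) ?_ hp
    refine IsTensor.of_eq (.cons (A := bang A) (vacuum a : Bang k (den v A))
      (.cons (A := bang A) (vacuum a : Bang k (den v A)) .nil)) ?_
    change TensorProduct.assoc k _ _ k
      (Coalgebra.comul (R := k) (vacuum a : Bang k (den v A)) ⊗ₜ[k] (1 : k)) = _
    rw [(isGroupLikeElem_vacuum a).comul_eq_tmul_self]
    rfl
  tensorR {Γ Δ A B p q L₁ L₂ a b} hp hq := by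
    obtain ⟨x, hx, rfl⟩ := hp
    obtain ⟨z, hz, rfl⟩ := hq
    obtain ⟨y, hy, e⟩ := appendIso_isTensor hx hz
    refine ⟨y, hy, ?_⟩
    exact congrArg (TensorProduct.map (p.den v) (q.den v)) e
  prom {Γ A p L a} hΓ hp := by
    subst hΓ
    obtain ⟨x, hx, rfl⟩ := hp
    exact ⟨x, hx, bangLift_groupLike _ (isGroupLikeElem_isTensor L hx)⟩

end

/-! ### Proofs that compute tables of booleans. -/

/-- The pairing of `n` proofs of `Γ ⊢ A`. -/
def ampFam {Γ : List (Formula α)} {A : Formula α} : (n : ℕ) → (ℕ → Proof Γ A) → Proof Γ (A.pow n)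
  -- A dummy case, matching the convention that `A.pow 0` is `A`. Indexing by `ℕ` makes the
  -- recursion a plain shift, with no bounds to carry.
  | 0, g => g 0
  | 1, g => g 0
  | n + 2, g => ampR (g 0) (ampFam (n + 1) fun i => g (i + 1))

theorem cut_ampFam_projProof {Γ : List (Formula α)} {A : Formula α} :
    (n : ℕ) → (g : ℕ → Proof Γ A) → (i : Fin n) →
    CutEq (cut [] [] (ampFam n g) (projProof A n i)) (g i)
  | 0, _, i => i.elim0
  | 1, g, ⟨0, _⟩ => .cut_ax (g 0)
  | _ + 2, g, ⟨0, _⟩ => (CutEq.amp_amp0 [] [] _ _ (ax A)).trans (.cut_ax (g 0))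
  | n + 2, g, ⟨i + 1, hi⟩ => (CutEq.amp_amp1 [] [] _ _ _).trans
      (cut_ampFam_projProof (n + 1) (fun i => g (i + 1)) ⟨i, Nat.lt_of_succ_lt_succ hi⟩)

section Table

variable {ι : Type} (sz : ι → ℕ) (A : Formula α) (m : ℕ)

/-- The proof of `Aᵐ, bool, …, bool ⊢ A` that selects a component of its first hypothesis by the
table `f`, whose arguments are the booleans, the last hypothesis first. -/
def tableProof : (ls : List ι) → (List ℕ → Fin m) →
    Proof (A.pow m :: ls.reverse.map fun l => nbool (sz l) A) A
  | [], f => projProof A m (f [])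
  -- The boolean for `l` is the last hypothesis. Applied to the tuple of subtables, it selects the
  -- branch belonging to its value.
  | l :: ls, f => recast (by simp [nbool])
      (limpL (Γ := A.pow m :: ls.reverse.map fun l => nbool (sz l) A) [] []
        (ampFam (sz l) fun i => tableProof ls fun t => f (i :: t)) (ax A))

/-- Booleans as closed inputs. -/
def boolInputs (z : ∀ l, Fin (sz l)) (ls : List ι) : List (ClosedInput α) :=
  ls.map fun l => ⟨nbool (sz l) A, boolProof A (sz l) (z l)⟩

theorem map_fst_boolInputs (z : ∀ l, Fin (sz l)) (ls : List ι) :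
    (boolInputs sz A z ls).map Sigma.fst = ls.map fun l => nbool (sz l) A := by
  simp [boolInputs, Function.comp_def]

/-- The hypothesis `Aᵐ` is left open as the prefix `[A.pow m]`. A subsequent `limpR` discharges it
and turns the resulting projection into a boolean. -/
theorem closeAll_tableProof (z : ∀ l, Fin (sz l)) (ls : List ι) (f : List ℕ → Fin m) :
    CutEq (closeAll (boolInputs sz A z ls.reverse) [A.pow m] [] (tableProof sz A m ls f)
      (by simp [map_fst_boolInputs])) (projProof A m (f (ls.map fun l => (z l : ℕ)))) := by
  induction ls generalizing f with
  | nil => exact .refl _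
  | cons l ls ih =>
    have e : boolInputs sz A z (l :: ls).reverse = boolInputs sz A z ls.reverse ++
        [⟨nbool (sz l) A, boolProof A (sz l) (z l)⟩] := by simp [boolInputs]
    -- The list occurs in the type of the equality argument of `closeAll`, so it is generalised
    -- before being replaced by a concatenation.
    have key : ∀ {L : List (ClosedInput α)} {h}, L = boolInputs sz A z ls.reverse ++
        [⟨nbool (sz l) A, boolProof A (sz l) (z l)⟩] →
        CutEq (closeAll L [A.pow m] [] (tableProof sz A m (l :: ls) f) h)
          (projProof A m (f ((l :: ls).map fun l => (z l : ℕ)))) := by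
      rintro _ h rfl
      refine closeAll_append.trans (CutEq.trans (.closeAll_congr (h' := ?_) ?_ rfl rfl)
        (ih fun t => f (z l :: t)))
      · simp [map_fst_boolInputs]
      · let P := ampFam (sz l) fun i => tableProof sz A m ls fun t => f (i :: t)
        have e' : [A.pow m] ++ (boolInputs sz A z ls.reverse).map Sigma.fst =
          [] ++ (A.pow m :: ls.reverse.map fun l => nbool (sz l) A) := by
          simp [map_fst_boolInputs]
        refine CutEq.trans (.closeAll_congr (h' := ?_) (cutEq_recast _ _) e' rfl) ?_
        · simp [nbool]
        -- The principal cut of `limpR` against `limpL` feeds the tuple of subtables to the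
        -- projection for `z l`; the `&`-cuts then leave the chosen subtable.
        refine CutEq.trans (closeAll_cons (q := recast (by simp [nbool]) (limpL [] [] P (ax A))) ?_)
          ((CutEq.limp_limp [] [] (projProof A (sz l) (z l)) P (ax A)).trans ?_)
        · exact (cutEq_recast _ _).trans (cutEq_recast _ _).symm
        · exact (CutEq.cut_ax _).trans (cut_ampFam_projProof _ _ _)
    exact key e

theorem cutEval_tableProof (z : ∀ l, Fin (sz l)) (ls : List ι) (f : List ℕ → Fin m) :
    CutEval (limpR (tableProof sz A m ls f)) (boolInputs sz A z ls.reverse)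
      (boolProof A m (f (ls.map fun l => (z l : ℕ)))) :=
  ⟨by simp [map_fst_boolInputs], (closeAll_limpR (Δ₁ := []) (Δ₂ := [])
    (h := by simp [map_fst_boolInputs])).trans
    (.congr_limpR (closeAll_tableProof sz A m z ls f))⟩

end Table

/-! ### Denotations of table proofs. -/

noncomputable section

variable {k : Type u} [Field k] {v : α → ModuleCat.{u} k}

/-- The `n`-tuple of vectors as an element of `⟦Aⁿ⟧`. -/
def tupleVec {A : Formula α} : (n : ℕ) → (ℕ → den v A) → den v (A.pow n)
  | 0, y => y 0
  | 1, y => y 0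
  | n + 2, y => ((y 0, tupleVec (n + 1) fun i => y (i + 1)) : den v A × den v (A.pow (n + 1)))

theorem vecEval_ampFam {Γ : List (Formula α)} {A : Formula α} {L : List (VecInput v)} :
    (n : ℕ) → {g : ℕ → Proof Γ A} → {y : ℕ → den v A} → (∀ i, VecEval (g i) L (y i)) →
    VecEval (ampFam n g) L (tupleVec n y)
  | 0, _, _, h => h 0
  | 1, _, _, h => h 0
  | n + 2, g, y, h => by
    obtain ⟨x, hx, h1⟩ := vecEval_ampFam (n + 1) fun i => h (i + 1)
    exact ⟨x, hx, Prod.ext ((h 0).den_eq hx) h1⟩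

theorem vecEval_ax {A : Formula α} (a : den v A) : VecEval (ax A) [⟨A, a⟩] a :=
  ⟨_, .cons a .nil, one_smul k a⟩

theorem vecEval_projProof {A : Formula α} : (n : ℕ) → (i : Fin n) → (y : ℕ → den v A) →
    VecEval (projProof A n i) [⟨A.pow n, tupleVec n y⟩] (y i)
  | 0, i, _ => i.elim0
  | 1, ⟨0, _⟩, y => vecEval_ax (y 0)
  | n + 2, ⟨0, _⟩, y => by
    refine VecEval.comp_inCtx (f := LRule.den v (.ampL0 A (A.pow (n + 1))))
      (L := [⟨A.pow (n + 2), tupleVec (n + 2) y⟩]) (L' := [⟨A, y 0⟩]) (L₁ := []) (L₂ := []) rfl rfl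
      (.cons (A := A.pow (n + 2)) _ .nil) ?_ (vecEval_ax (y 0))
    exact .cons (y 0) .nil
  | n + 2, ⟨i + 1, hi⟩, y => by
    refine VecEval.comp_inCtx (f := LRule.den v (.ampL1 A (A.pow (n + 1))))
      (L := [⟨A.pow (n + 2), tupleVec (n + 2) y⟩])
      (L' := [⟨A.pow (n + 1), tupleVec (n + 1) fun i => y (i + 1)⟩]) (L₁ := []) (L₂ := []) rfl rfl
      (.cons (A := A.pow (n + 2)) _ .nil) ?_
      (vecEval_projProof (n + 1) ⟨i, Nat.lt_of_succ_lt_succ hi⟩ fun i => y (i + 1))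
    exact .cons (A := A.pow (n + 1)) _ .nil

/-- The linear map given by a vector of `⟦A ⊸ B⟧`, applied to a vector of `⟦A⟧`. -/
def applyVec {A B : Formula α} (t : den v A) : den v (limp A B) →ₗ[k] den v B :=
  (LinearMap.applyₗ t : (den v A →ₗ[k] den v B) →ₗ[k] den v B)

theorem vecEval_limpR {Γ : List (Formula α)} {A B : Formula α} {p : Proof (A :: Γ) B}
    {L : List (VecInput v)} {φ : den v (limp A B)}
    (h : ∀ t : den v A, VecEval p (⟨A, t⟩ :: L) (applyVec t φ)) : VecEval (limpR p) L φ := by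
  -- The instance at `0` is used only to obtain the tensor of `L` in the context `Γ`.
  obtain ⟨_, hx, _⟩ := h 0
  cases hx with
  | cons _ hx =>
    exact ⟨_, hx, LinearMap.ext fun t => (h t).den_eq (.cons t hx)⟩

theorem vecEval_limpL {Γ : List (Formula α)} {A B : Formula α} {p : Proof Γ A}
    {L : List (VecInput v)} {a : den v A} (h : VecEval p L a) (φ : den v (limp A B)) :
    VecEval (limpL [] [] p (ax B)) (L ++ [⟨limp A B, φ⟩]) (applyVec a φ) := by
  obtain ⟨x, hx, rfl⟩ := h
  obtain ⟨y, hy, hy'⟩ := inCtx_isTensor (f := toCtx v (p.den v)) (M := [⟨limp A B, φ⟩])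
    (L' := [⟨A, p.den v x⟩]) hx (.cons _ .nil) (.cons (A := limp A B) φ .nil)
  refine ⟨y, hy, ?_⟩
  have hφ : evalCtx v A B (p.den v x ⊗ₜ[k] (φ ⊗ₜ[k] (1 : k) : den v (limp A B) ⊗[k] k)) =
      (applyVec (p.den v x) φ ⊗ₜ[k] (1 : k) : den v B ⊗[k] k) := by
    change (applyVec (p.den v x) ((1 : k) • φ)) ⊗ₜ[k] (1 : k) = _
    rw [one_smul]
  obtain ⟨z, hz, hz'⟩ := inCtx_isTensor (f := evalCtx v A B) (M := [])
    (L := [⟨A, p.den v x⟩, ⟨limp A B, φ⟩]) (L' := [⟨B, applyVec (p.den v x) φ⟩])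
    (.cons _ (.cons (A := limp A B) φ .nil)) (.of_eq (.cons _ .nil) hφ) .nil
  rw [hz.eq hy'] at hz'
  exact (vecEval_ax _).den_eq hz'

/-- A boolean denotes a projection, so a combination of booleans, viewed as a linear map, forms the
corresponding combination of the entries of a tuple. Every sum in the semantic formula arises from
this. -/
theorem applyVec_boolVec {A : Formula α} {n : ℕ} (c : Fin n → k) (y : ℕ → den v A) :
    applyVec (tupleVec n y) (boolVec v A c) = ∑ i, c i • y i := by
  refine (map_sum (applyVec (v := v) (A := A.pow n) (B := A) (tupleVec n y)) _ _).trans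
    (Finset.sum_congr rfl fun i _ => ?_)
  refine (map_smul (applyVec (v := v) (A := A.pow n) (B := A) (tupleVec n y)) (c i) _).trans
    (congrArg (c i • ·) ?_)
  exact (vecEval_projProof n i y).den_eq (.cons (A := A.pow n) _ .nil)

section Table

variable {ι : Type} (sz : ι → ℕ) (A : Formula α) (m : ℕ)

/-- The sum of `f` over all values of the variables `ls`, weighted by the coefficients `c`. -/
def tableSum {V : Type u} [AddCommGroup V] [Module k V] (c : ∀ l, Fin (sz l) → k) :
    List ι → (List ℕ → V) → V
  | [], f => f []
  | l :: ls, f => ∑ i, c l i • tableSum c ls fun t => f (i :: t)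

variable {sz} in
theorem map_tableSum {V W : Type u} [AddCommGroup V] [Module k V] [AddCommGroup W] [Module k W]
    (φ : V →ₗ[k] W) (c : ∀ l, Fin (sz l) → k) (ls : List ι) (f : List ℕ → V) :
    φ (tableSum sz c ls f) = tableSum sz c ls fun t => φ (f t) := by
  induction ls generalizing f with
  | nil => rfl
  | cons l ls ih => simp [tableSum, ih]

/-- Combinations of booleans as inputs. -/
def boolVecInputs (c : ∀ l, Fin (sz l) → k) (ls : List ι) : List (VecInput v) :=
  ls.map fun l => ⟨nbool (sz l) A, boolVec v A (c l)⟩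

/-- By induction the tuple of subtables evaluates to the tuple of inner sums, and `applyVec_boolVec`
adds the sum over the variable `l`. All variables are summed, including those that `f` ignores. -/
theorem vecEval_tableProof_aux (c : ∀ l, Fin (sz l) → k) (ls : List ι) (f : List ℕ → Fin m)
    (t : den v (A.pow m)) :
    VecEval (tableProof sz A m ls f) (⟨A.pow m, t⟩ :: boolVecInputs sz A c ls.reverse)
      (tableSum sz c ls fun r => applyVec t ((boolProof A m (f r)).val v)) := by
  induction ls generalizing f with
  | nil => exact ⟨_, .cons (A := A.pow m) t .nil, rfl⟩
  | cons l ls ih =>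
    have h := vecEval_limpL (v := v) (vecEval_ampFam (sz l) fun i => ih fun r => f (i :: r))
      (boolVec v A (c l))
    rw [applyVec_boolVec] at h
    exact EvalModel.E.recast (M := vecModel v) h (by simp [boolVecInputs]; rfl)

theorem vecEval_tableProof (c : ∀ l, Fin (sz l) → k) (ls : List ι) (f : List ℕ → Fin m) :
    VecEval (C := nbool m A) (limpR (tableProof sz A m ls f)) (boolVecInputs sz A c ls.reverse)
      (tableSum sz c ls fun r => (boolProof A m (f r)).val v) := by
  refine vecEval_limpR fun t => ?_
  have e := map_tableSum (applyVec (v := v) (A := A.pow m) (B := A) t) c ls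
    fun r => (boolProof A m (f r)).val v
  exact e.symm ▸ vecEval_tableProof_aux sz A m c ls f t

end Table

end

/-! ### Plain proofs from tables with repeated and reordered reads. -/

section Component

variable {ι : Type}

/-- The list `ls` with multiplicities `cnt`. -/
def multLabels (cnt : ι → ℕ) (ls : List ι) : List ι :=
  ls.flatMap fun l => List.replicate (cnt l) l

theorem count_multLabels [DecidableEq ι] (cnt : ι → ℕ) (ls : List ι) (x : ι) :
    (multLabels cnt ls).count x = ls.count x * cnt x := by
  induction ls with
  | nil => simp [multLabels]
  | cons l ls ih =>
    rw [multLabels, List.flatMap_cons, List.count_append, ← multLabels, ih, List.count_replicate,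
      List.count_cons]
    by_cases h : l = x
    · subst h; simp; ring
    · simp [h]

/-- A table may read its variables in any order and repeatedly, whereas `plainForm` expects the
copies of each hypothesis to be adjacent and in the order of the context. The permutation bridges
the two, with multiplicity `0` for variables never read. -/
theorem perm_multLabels_count [DecidableEq ι] {ls ms : List ι} (hls : ls.Nodup)
    (h : ∀ l ∈ ms, l ∈ ls) : ms.Perm (multLabels (fun l => ms.count l) ls) := by
  rw [List.perm_iff_count]
  intro x
  rw [count_multLabels]
  by_cases hx : x ∈ ls
  · rw [List.count_eq_one_of_mem hls hx, one_mul]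
  · rw [List.count_eq_zero_of_not_mem hx, List.count_eq_zero_of_not_mem fun h' => hx (h x h'),
      zero_mul]

/-- A table can be rearranged along a permutation of its variables. -/
theorem exists_table_perm (sz : ι → ℕ) {T : Type} {ls ls' : List ι} (h : ls.Perm ls')
    (f : List ℕ → T) : ∃ f' : List ℕ → T, (∀ z : ι → ℕ, f' (ls'.map z) = f (ls.map z)) ∧
      ∀ (k : Type u) [Field k] (V : Type u) [AddCommGroup V] [Module k V]
        (c : ∀ l, Fin (sz l) → k) (W : T → V),
        tableSum sz c ls' (fun r => W (f' r)) = tableSum sz c ls fun r => W (f r) := by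
  induction h generalizing f with
  | nil => exact ⟨f, fun _ => rfl, fun _ _ _ _ _ _ _ => rfl⟩
  | cons l _ ih =>
    choose g hg hg' using fun i => ih fun t => f (i :: t)
    -- The value at `[]` is never used, since at least one variable is read. The new table is built
    -- before any field or vector space is chosen, so it serves all of them.
    refine ⟨fun r => match r with
      | [] => f []
      | i :: t => g i t, fun z => hg _ z, fun k _ V _ _ c W => ?_⟩
    exact Finset.sum_congr rfl fun i _ => congrArg (c l i • ·) (hg' i k V c W)
  | swap l l' ls =>
    refine ⟨fun r => match r with
      | i :: j :: t => f (j :: i :: t)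
      | r => f r, fun z => rfl, fun k _ V _ _ c W => ?_⟩
    simp only [tableSum, Finset.smul_sum]
    rw [Finset.sum_comm]
    exact Finset.sum_congr rfl fun i _ => Finset.sum_congr rfl fun j _ => smul_comm _ _ _
  | trans _ _ ih₁ ih₂ =>
    obtain ⟨g, hg, hg'⟩ := ih₁ f
    obtain ⟨g', h, h'⟩ := ih₂ g
    exact ⟨g', fun z => (h z).trans (hg z),
      fun k _ V _ _ c W => (h' k V c W).trans (hg' k V c W)⟩

theorem multCtx_map (cnt : ι → ℕ) (F : ι → Formula α) : (ls : List ι) →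
    multCtx id (ls.map F) (fun j => cnt (ls[j.1]'(by simpa using j.2))) =
      (multLabels cnt ls).map F
  | [] => rfl
  | l :: ls => by
    have ih := multCtx_map cnt F ls
    simp only [multLabels, List.flatMap_cons, List.map_append, List.map_replicate] at ih ⊢
    exact congrArg (List.replicate (cnt l) (F l) ++ ·) ih

theorem multEnv_map {D : Formula α → Type*} (cnt : ι → ℕ) (g : ι → Sigma D) : (ls : List ι) →
    EvalModel.multEnv (ls.map g) (fun j => cnt (ls[j.1]'(by simpa using j.2))) =
      (multLabels cnt ls).map g
  | [] => rfl
  | l :: ls => by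
    have ih := multEnv_map cnt g ls
    simp only [multLabels, List.flatMap_cons, List.map_append, List.map_replicate] at ih ⊢
    exact congrArg (List.replicate (cnt l) (g l) ++ ·) ih

/-- `(ls.map g).map Sigma.fst` and `ls.map F` are only propositionally equal, and the proof `p`
depends on this list. The context is therefore generalised in `key` before `E.plainForm` is applied.
-/
theorem EvalModel.E.plainForm_map {M : EvalModel α} {C : Formula α} {y : M.D C} {cnt : ι → ℕ}
    {F : ι → Formula α} {g : ι → Sigma M.D} {ls : List ι} (hg : ∀ l, (g l).1 = F l)
    {p : Proof (multCtx id (ls.map F) (fun j => cnt (ls[j.1]'(by simpa using j.2)))) C}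
    (hp : M.E p ((multLabels cnt ls).map g) y) :
    M.E (Proof.plainForm (ls.map F) _ p) ((ls.map g).map M.prI) y := by
  have key : ∀ {Γ : List (Formula α)} {d : Fin Γ.length → ℕ} {p : Proof (multCtx id Γ d) C}
      (h : Γ = (ls.map g).map Sigma.fst), (∀ j, d j = cnt (ls[j.1]'(by
        exact j.2.trans_eq (by simp [h])))) →
      M.E p ((multLabels cnt ls).map g) y →
      M.E (Proof.plainForm Γ d p) ((ls.map g).map M.prI) y := by
    rintro _ d p rfl hd hp
    refine EvalModel.E.plainForm ?_
    rw [← multEnv_map] at hp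
    have : d = _ := funext hd
    subst this
    exact hp
  refine key ?_ (fun _ => rfl) hp
  simp [Function.comp_def, hg]

/-- Every table on the hypotheses `ls`, with any multiplicities, is computed by a plain proof. -/
theorem exists_isPlain_table [DecidableEq ι] (sz : ι → ℕ) (A : Formula α) {m : ℕ}
    {ls ms : List ι} (hls : ls.Nodup) (hms : ∀ l ∈ ms, l ∈ ls) (f : List ℕ → Fin m)
    {As : List (Formula α)} (hAs : As = ls.map fun l => nbool (sz l) A) :
    ∃ ψ : Proof (As.map bang) (nbool m A), IsPlain As ψ ∧
      (∀ z, CutEval ψ ((boolInputs sz A z ls).map (cutModel α).prI)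
        (boolProof A m (f (ms.map fun l => (z l : ℕ))))) ∧
      ∀ (k : Type u) [Field k] (v : α → ModuleCat.{u} k) (c : ∀ l, Fin (sz l) → k),
        VecEval ψ ((boolVecInputs sz A c ls).map (vecModel v).prI)
          (tableSum sz c ms fun r => (boolProof A m (f r)).val v) := by
  subst hAs
  let cnt : ι → ℕ := fun l => ms.count l
  -- The reads are grouped by hypothesis and then reversed, because `tableProof` takes its variables
  -- with the last hypothesis first.
  obtain ⟨f', h1, h2⟩ := exists_table_perm.{u} sz
    ((perm_multLabels_count hls hms).trans (List.reverse_perm _).symm) f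
  let p : Proof (multCtx id (ls.map fun l => nbool (sz l) A)
      (fun j => cnt (ls[j.1]'(by simpa using j.2)))) (nbool m A) :=
    recast (by rw [List.reverse_reverse, multCtx_map])
    (limpR (tableProof sz A m (multLabels cnt ls).reverse f'))
  refine ⟨plainForm _ (fun j => cnt (ls[j.1]'(by simpa using j.2))) p,
    ⟨_, p, .refl _⟩, fun z => ?_, fun k _ v c => ?_⟩
  · have H := cutEval_tableProof sz A m z (multLabels cnt ls).reverse f'
    rw [h1 fun l => (z l : ℕ)] at H
    exact EvalModel.E.plainForm_map (M := cutModel α) (F := fun l => nbool (sz l) A)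
      (g := fun l => ⟨nbool (sz l) A, boolProof A (sz l) (z l)⟩) (cnt := cnt) (p := p)
      (fun _ => rfl) (EvalModel.E.recast (M := cutModel α) H (by rw [List.reverse_reverse]; rfl))
  · have H := vecEval_tableProof (v := v) sz A m c (multLabels cnt ls).reverse f'
    have e : tableSum sz c (multLabels cnt ls).reverse (fun r => (boolProof A m (f' r)).val v) =
      tableSum sz c ms fun r => (boolProof A m (f r)).val v := 
      h2 k (den v (nbool m A)) c fun o => (boolProof A m o).val v
    rw [e] at H
    exact EvalModel.E.plainForm_map (M := vecModel v) (F := fun l => nbool (sz l) A)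
      (g := fun l => ⟨nbool (sz l) A, boolVec v A (c l)⟩) (cnt := cnt) (p := p)
      (fun _ => rfl) (EvalModel.E.recast (M := vecModel v) H (by rw [List.reverse_reverse]; rfl))

end Component

/-! ### Tables for one step of the machine. -/

section Cells

variable {s n : ℕ}

/-- The number of values of a variable: a tape square `some p` or the state `none`. -/
def labelSize (s n : ℕ) : Option ℤ → ℕ
  | some _ => s
  | none => n

/-- The tape squares in positions `-h, …, h` and the state. -/
def inputLabels (h : ℕ) : List (Option ℤ) :=
  (List.ofFn fun j : Fin (2 * h + 1) => some ((j : ℤ) - h)) ++ [none]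

theorem nodup_inputLabels (h : ℕ) : (inputLabels h).Nodup := by
  rw [inputLabels, List.nodup_append]
  refine ⟨List.nodup_ofFn.2 fun i j hij => ?_, List.nodup_singleton _, ?_⟩
  · simp only [Option.some.injEq] at hij
    exact Fin.ext (by omega)
  · simp [List.mem_ofFn]

theorem some_mem_inputLabels {h : ℕ} {p : ℤ} (hp : |p| ≤ h) : some p ∈ inputLabels h := by
  rw [abs_le] at hp
  refine List.mem_append_left _ (List.mem_ofFn.2 ⟨⟨(p + h).toNat, by omega⟩, ?_⟩)
  simp only [Option.some.injEq]
  omega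

theorem none_mem_inputLabels (h : ℕ) : none ∈ inputLabels h := by
  simp [inputLabels]

/-- The variables that determine the square in position `p` after the new symbol is written. -/
def cellLabels (h : ℕ) (p : ℤ) : List (Option ℤ) :=
  if p = 0 then [some 0, none] else if |p| ≤ h then [some p] else []

theorem mem_inputLabels_of_mem_cellLabels {h : ℕ} {p : ℤ} {l : Option ℤ}
    (hl : l ∈ cellLabels h p) : l ∈ inputLabels h := by
  unfold cellLabels at hl
  split_ifs at hl with h1 h2
  · rcases List.mem_pair.1 hl with rfl | rfl
    · exact some_mem_inputLabels (by simp)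
    · exact none_mem_inputLabels h
  · rw [List.mem_singleton.1 hl]; exact some_mem_inputLabels h2
  · simp at hl

variable [NeZero s] (δ : Fin s × Fin n → Fin s × Fin n × Turing.Dir) (h : ℕ)

/-- The symbol in position `p` after the new symbol is written. -/
def newCell (z : ∀ l, Fin (labelSize s n l)) (p : ℤ) : Fin s :=
  if p = 0 then (δ (z (some 0), z none)).1 else if |p| ≤ h then z (some p) else 0

/-- The values of the variables in a configuration. -/
def configValues (c : Config s n) : ∀ l, Fin (labelSize s n l)
  | some p => c.tape (c.head + p)
  | none => c.state

/-- Position `p` is relative to the old head, before the move. The blank hypothesis enters in the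
last case, where `newCell` returns `0` without reading anything. -/
theorem newCell_configValues {c : Config s n}
    (hc : ∀ p : ℤ, (h : ℤ) < |p - c.head| → c.tape p = 0) (p : ℤ) :
    newCell δ h (configValues c) p = (c.step δ).tape (c.head + p) := by
  change _ = Function.update c.tape c.head (δ (c.tape c.head, c.state)).1 (c.head + p)
  by_cases h1 : p = 0
  · subst h1
    refine (if_pos rfl).trans ?_
    rw [add_zero, Function.update_self]
    change (δ (c.tape (c.head + 0), c.state)).1 = _
    rw [add_zero]
  · rw [Function.update_of_ne (by simpa using h1)]
    refine (if_neg h1).trans ?_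
    by_cases h2 : |p| ≤ h
    · exact if_pos h2
    · exact (if_neg h2).trans (hc (c.head + p) (by simpa using h2)).symm

variable [NeZero n]

/-- The transition for a symbol and a state given as numbers. -/
def natStep (i q : ℕ) : Fin s × Fin n × Turing.Dir := δ (Fin.ofNat s i, Fin.ofNat n q)

theorem natStep_val (i : Fin s) (q : Fin n) : natStep δ i q = δ (i, q) := by
  simp [natStep]

/-- The table that reads the variables `cellLabels h p` and continues with the symbol in position
`p` after the new symbol is written. -/
def cellTable {T : Type} (p : ℤ) (K : Fin s → List ℕ → T) : List ℕ → T :=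
  if p = 0 then fun
    | i :: q :: l => K (natStep δ i q).1 l
    | _ => K 0 []
  else if |p| ≤ h then fun
    | i :: l => K (Fin.ofNat s i) l
    | [] => K 0 []
  else K 0

/-- The continuation `K` receives the symbol and the unread values, so that the reads of two cells
can be chained. Values are natural numbers because symbols and states have different ranges;
`Fin.ofNat` is the identity on genuine values. -/
theorem cellTable_map {T : Type} (z : ∀ l, Fin (labelSize s n l)) (p : ℤ)
    (K : Fin s → List ℕ → T) (ls : List (Option ℤ)) :
    cellTable δ h p K ((cellLabels h p ++ ls).map fun l => (z l : ℕ)) =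
      K (newCell δ h z p) (ls.map fun l => (z l : ℕ)) := by
  unfold cellTable cellLabels
  split_ifs with h1 h2
  · rw [show newCell δ h z p = (δ (z (some 0), z none)).1 from if_pos h1]
    exact congrArg (fun r => K r.1 _) (natStep_val δ (z (some 0)) (z none))
  · rw [show newCell δ h z p = z (some p) from (if_neg h1).trans (if_pos h2)]
    exact congrArg (fun r => K r _) (Fin.ofNat_val_eq_self (n := s) (z (some p)))
  · rw [show newCell δ h z p = 0 from (if_neg h1).trans (if_neg h2)]
    rfl

/-- The variables that determine the symbol in position `m` relative to the new head position. -/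
def symbolLabels (m : ℤ) : List (Option ℤ) :=
  -- The trailing `[]` gives the second read the shape `cellLabels h p ++ ls` used by
  -- `cellTable_map` and `tableSum_cellTable`. When `m` is `1` or `-1`, the variables `some 0` and
  -- `none` occur twice.
  some 0 :: none :: (cellLabels h (m - 1) ++ (cellLabels h (m + 1) ++ []))

/-- The symbol in position `m` relative to the new head position, as a table. -/
def symbolTable (m : ℤ) : List ℕ → Fin s
  | i :: q :: l => cellTable δ h (m - 1) (fun σ => cellTable δ h (m + 1) fun τ _ =>
      match (natStep δ i q).2.2 with
      | .left => σ
      | .right => τ) l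
  | _ => 0

theorem symbolTable_map (z : ∀ l, Fin (labelSize s n l)) (m : ℤ) :
    symbolTable δ h m ((symbolLabels h m).map fun l => (z l : ℕ)) =
      match (δ (z (some 0), z none)).2.2 with
      | .left => newCell δ h z (m - 1)
      | .right => newCell δ h z (m + 1) := by
  refine (cellTable_map δ h z (m - 1) (fun σ => cellTable δ h (m + 1) fun τ _ =>
    match (natStep δ (z (some 0)) (z none)).2.2 with
    | .left => σ
    | .right => τ) (cellLabels h (m + 1) ++ [])).trans
    ((cellTable_map δ h z (m + 1) _ []).trans ?_)
  rw [(natStep_val δ (z (some 0)) (z none) : natStep δ _ _ = _)]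

/-- The new state, as a table. -/
def stateTable : List ℕ → Fin n
  | i :: q :: _ => (natStep δ i q).2.1
  | _ => 0

theorem stateTable_configValues (c : Config s n) :
    stateTable δ ([some 0, none].map fun l => (configValues c l : ℕ)) = (c.step δ).state := by
  refine (congrArg (fun r => r.2.1) (natStep_val δ (c.tape (c.head + 0)) c.state)).trans ?_
  rw [add_zero]
  rfl

/-- After a move to the left, new position `m` is the absolute square `(head - 1) + m = head + (m -
1)`; a move to the right is symmetric. -/
theorem symbolTable_configValues {c : Config s n}
    (hc : ∀ p : ℤ, (h : ℤ) < |p - c.head| → c.tape p = 0) (m : ℤ) :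
    symbolTable δ h m ((symbolLabels h m).map fun l => (configValues c l : ℕ)) =
      (c.step δ).tape ((c.step δ).head + m) := by
  have e : (c.step δ).head = match (δ (c.tape c.head, c.state)).2.2 with
      | .left => c.head - 1
      | .right => c.head + 1 := rfl
  have e' : δ (configValues c (some 0), configValues c none) = δ (c.tape c.head, c.state) := by
    change δ (c.tape (c.head + 0), c.state) = _
    rw [add_zero]
  rw [symbolTable_map, newCell_configValues δ h hc, newCell_configValues δ h hc, e, e']
  cases (δ (c.tape c.head, c.state)).2.2
  · exact congrArg (c.step δ).tape (by ring)
  · exact congrArg (c.step δ).tape (by ring)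

end Cells

/-! ### Multilinear expansion of the step tables. -/

noncomputable section Sums

variable {s n : ℕ} {k : Type u} [Field k] {v : α → ModuleCat.{u} k}

/-- The coefficients of the input vectors. -/
def labelCoeff (a : ℤ → Fin s → k) (b : Fin n → k) : ∀ l, Fin (labelSize s n l) → k
  | some p => a p
  | none => b

variable [NeZero s] (A : Formula α)
  (δ : Fin s × Fin n → Fin s × Fin n × Turing.Dir) (h : ℕ) (a : ℤ → Fin s → k) (b : Fin n → k)

/-- The sum of `g` over the symbols in position `p` after the new symbol is written, weighted by
the coefficients of the input vectors. -/
def cellSum {V : Type u} [AddCommGroup V] [Module k V] (p : ℤ) (g : Fin s → V) : V :=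
  if p = 0 then ∑ i, ∑ q, (a 0 i * b q) • g (δ (i, q)).1
  else if |p| ≤ h then ∑ i, a p i • g i
  else g 0

variable {V : Type u} [AddCommGroup V] [Module k V]

/-- A cell that is read but not used leaves only the total weight of its variables; a cell outside
the window reads nothing and has weight `1`. -/
theorem cellSum_const (p : ℤ) (x : V) :
    cellSum δ h a b p (fun _ => x) = cellMass h a b p • x := by
  unfold cellSum cellMass
  split_ifs
  · simp only [← Finset.sum_smul, Finset.sum_mul_sum]
  · rw [Finset.sum_smul]
  · rw [one_smul]

theorem cellSum_smul (p : ℤ) (r : k) (g : Fin s → V) :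
    cellSum δ h a b p (fun σ => r • g σ) = r • cellSum δ h a b p g := by
  unfold cellSum
  split_ifs
  · simp only [Finset.smul_sum, smul_comm r]
  · simp only [Finset.smul_sum, smul_comm r]
  · rfl

theorem cellSum_boolProof (p : ℤ) :
    cellSum δ h a b p (fun σ => (boolProof A s σ).val v) = cellVec v A δ h a b p := rfl

variable [NeZero n]

theorem tableSum_cellTable {T : Type} (p : ℤ) (K : Fin s → List ℕ → T) (ls : List (Option ℤ))
    (W : T → V) :
    tableSum (labelSize s n) (labelCoeff a b) (cellLabels h p ++ ls)
        (fun r => W (cellTable δ h p K r)) =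
      cellSum δ h a b p fun σ =>
        tableSum (labelSize s n) (labelCoeff a b) ls fun r => W (K σ r) := by
  unfold cellTable cellLabels cellSum
  split_ifs with h1 h2
  · change ∑ i : Fin s, a 0 i • ∑ q : Fin n, b q • tableSum (labelSize s n) (labelCoeff a b) ls
      (fun r => W (K (natStep δ i q).1 r)) = _
    simp only [Finset.smul_sum, smul_smul, natStep_val]
  · change ∑ i : Fin s, a p i • tableSum (labelSize s n) (labelCoeff a b) ls
      (fun r => W (K (Fin.ofNat s i) r)) = _
    simp only [Fin.ofNat_val_eq_self]
  · rfl

/-- Once the scanned symbol and state fix the direction, one neighbouring cell contributes its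
vector and the other only its mass. Grouping the pairs `(i, q)` by direction collects the
coefficients `dirMass`. -/
theorem tableSum_symbolTable (m : ℤ) :
    tableSum (labelSize s n) (labelCoeff a b) (symbolLabels h m)
        (fun r => (boolProof A s (symbolTable δ h m r)).val v) = relTheta v A δ h a b m := by
  have key : ∀ (i : Fin s) (q : Fin n),
      tableSum (labelSize s n) (labelCoeff a b)
        (cellLabels h (m - 1) ++ (cellLabels h (m + 1) ++ []))
        (fun r => (boolProof A s (symbolTable δ h m (i :: q :: r))).val v) =
      match (δ (i, q)).2.2 with
      | .left => cellMass h a b (m + 1) • cellVec v A δ h a b (m - 1)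
      | .right => cellMass h a b (m - 1) • cellVec v A δ h a b (m + 1) := by
    intro i q
    refine (tableSum_cellTable δ h a b (m - 1) (fun σ => cellTable δ h (m + 1) fun τ _ =>
      match (natStep δ i q).2.2 with
      | .left => σ
      | .right => τ) _ fun o => (boolProof A s o).val v).trans ?_
    simp only [tableSum_cellTable δ h a b (m + 1) _ _ fun o => (boolProof A s o).val v]
    simp only [tableSum, natStep_val]
    cases (δ (i, q)).2.2
    · simp only [cellSum_const, cellSum_smul, cellSum_boolProof]
    · simp only [cellSum_const, cellSum_boolProof]
  have e : tableSum (labelSize s n) (labelCoeff a b) (symbolLabels h m)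
        (fun r => (boolProof A s (symbolTable δ h m r)).val v) =
      ∑ i : Fin s, ∑ q : Fin n, (a 0 i * b q) • match (δ (i, q)).2.2 with
      | .left => cellMass h a b (m + 1) • cellVec v A δ h a b (m - 1)
      | .right => cellMass h a b (m - 1) • cellVec v A δ h a b (m + 1) := by
    change ∑ i : Fin s, a 0 i • ∑ q : Fin n, b q • tableSum (labelSize s n) (labelCoeff a b)
      (cellLabels h (m - 1) ++ (cellLabels h (m + 1) ++ []))
      (fun r => (boolProof A s (symbolTable δ h m (i :: q :: r))).val v) = _
    simp only [Finset.smul_sum, smul_smul, key]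
  -- Both direction masses are expanded over all pairs `(i, q)`; for each pair exactly one of the
  -- two direction conditions holds, so the summands agree.
  rw [e, relTheta, mul_smul, mul_smul, dirMass, dirMass]
  simp only [Finset.sum_smul, ← Finset.sum_add_distrib]
  refine Finset.sum_congr rfl fun i _ => Finset.sum_congr rfl fun q _ => ?_
  cases (δ (i, q)).2.2 <;> simp

theorem tableSum_stateTable :
    tableSum (labelSize s n) (labelCoeff a b) [some 0, none]
        (fun r => (boolProof A n (stateTable δ r)).val v) = relMu v A δ a b := by
  change ∑ i : Fin s, a 0 i • ∑ q : Fin n, b q • (boolProof A n (natStep δ i q).2.1).val v = _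
  simp only [Finset.smul_sum, smul_smul, natStep_val]
  rfl

end Sums

/-! ### Encodings as model values, and assembly of the step. -/

theorem conf_cutModel {s n : ℕ} (A : Formula α) (q : Fin n) : (N : ℕ) → (t : Fin N → Fin s) →
    (cutModel α).conf (X := nbool s A) (Y := nbool n A) (boolProof A n q) N
      (fun j => boolProof A s (t j)) = confProof s n A q N t
  | 0, _ => rfl
  | N + 1, t => congrArg (tensorR (prom (Γ := []) (boolProof A s (t 0))))
      (conf_cutModel A q N fun j => t j.succ)

theorem conf_vecModel {s n : ℕ} {k : Type u} [Field k] (v : α → ModuleCat.{u} k) (A : Formula α)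
    (μ : den v (nbool n A)) : (N : ℕ) → (θ : Fin N → den v (nbool s A)) →
    (vecModel v).conf (X := nbool s A) (Y := nbool n A) μ N θ = vacConf v s n A μ N θ
  | 0, _ => rfl
  | N + 1, θ => congrArg
      (fun t => ((vacuum (θ 0) : Bang k (den v (nbool s A))) ⊗ₜ[k] t :
        Bang k (den v (nbool s A)) ⊗[k] den v (confType s n A N)))
      (conf_vecModel v A μ N fun j => θ j.succ)

/-- The form in which both models are used: the values of the components on the promoted inputs
determine the value of the assembled proof on a whole encoded configuration. -/
theorem EvalModel.E.tensorLList_ofComponents {M : EvalModel.{w, x} α} {X Y X' Y' : Formula α}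
    {N N' : ℕ} {g : Fin N' → Proof ((List.replicate N X ++ [Y]).map bang) X'}
    {χ : Proof ((List.replicate N X ++ [Y]).map bang) Y'} {q : M.D Y} {t : Fin N → M.D X}
    {q' : M.D Y'} {t' : Fin N' → M.D X'} {K : List (Sigma M.D)}
    (hK : K = (List.ofFn fun j => (⟨X, t j⟩ : Sigma M.D)) ++ [(⟨Y, q⟩ : Sigma M.D)])
    (hg : ∀ j, M.E (g j) (K.map M.prI) (t' j)) (hχ : M.E χ (K.map M.prI) q') :
    M.E (Proof.tensorLList Y (List.replicate N X) []
        (Proof.ofComponents _ (List.replicate N' X') (replFam N' g) χ))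
      [⟨_, M.conf q N t⟩] (M.conf q' N' t') := by
  refine E.tensorLList (L₁ := []) rfl ?_
  rw [← hK]
  have key : ∀ {As : List (Formula α)} {g : Fin N' → Proof (As.map bang) X'}
      {χ : Proof (As.map bang) Y'}, As = K.map Sigma.fst →
      (∀ j, M.E (g j) (K.map M.prI) (t' j)) → M.E χ (K.map M.prI) q' →
      M.E (Proof.ofComponents As (List.replicate N' X') (replFam N' g) χ) (K.map M.prI)
        (M.conf q' N' t') := by
    rintro _ g χ rfl hg hχ
    exact E.ofComponents hχ hg
  refine key ?_ hg hχ
  simp [hK, List.map_ofFn, Function.comp_def]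

end SweedlerLL

open SweedlerLL in
theorem mainTheorem5 {α : Type w} (A : SweedlerLL.Formula α) (s n : ℕ) [NeZero s] [NeZero n]
    (δ : Fin s × Fin n → Fin s × Fin n × Turing.Dir) (h : ℕ) :
    ∃ relstep : SweedlerLL.Proof [SweedlerLL.confType s n A (2 * h + 1)]
        (SweedlerLL.confType s n A (2 * h + 3)),
      SweedlerLL.IsComponentwisePlain
        (List.replicate (2 * h + 1) (SweedlerLL.nbool s A)) (SweedlerLL.nbool n A)
        (List.replicate (2 * h + 3) (SweedlerLL.nbool s A)) (SweedlerLL.nbool n A) relstep ∧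
      (∀ c : SweedlerLL.Config s n, (∀ p : ℤ, (h : ℤ) < |p - c.head| → c.tape p = 0) →
        SweedlerLL.CutEq
          (SweedlerLL.Proof.cut [] []
            (SweedlerLL.confProof s n A c.state (2 * h + 1) (c.window h)) relstep)
          (SweedlerLL.confProof s n A (c.step δ).state (2 * h + 3) ((c.step δ).window (h + 1)))) ∧
      ∀ (k : Type u) [Field k] (v : α → ModuleCat.{u} k) (a : ℤ → Fin s → k) (b : Fin n → k),
        relstep.map v
          (SweedlerLL.vacConf v s n A (SweedlerLL.boolVec v A b) (2 * h + 1)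
              (fun j => SweedlerLL.boolVec v A (a ((j : ℤ) - h)))) =
          SweedlerLL.vacConf v s n A (SweedlerLL.relMu v A δ a b) (2 * h + 3)
            (fun j => SweedlerLL.relTheta v A δ h a b ((j : ℤ) - (h + 1))) := by
  -- This identifies the context of `relstep` with the labelled context of the tables; `labelSize`
  -- reduces to `s` on squares and to `n` on the state.
  have hAs : List.replicate (2 * h + 1) (nbool s A) ++ [nbool n A] =
      (inputLabels h).map fun l => nbool (labelSize s n l) A := by
    rw [inputLabels, List.map_append, List.map_ofFn]
    change _ = List.ofFn (fun _ : Fin (2 * h + 1) => nbool s A) ++ _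
    rw [List.ofFn_const]
    rfl
  -- The symbol table makes sense for every integer `m`; only `m = j - (h + 1)` with `j < 2 * h + 3`
  -- is used.
  choose g hg1 hg2 hg3 using fun m : ℤ => exists_isPlain_table.{u} (labelSize s n) A
    (nodup_inputLabels h) (ms := symbolLabels h m) (fun l hl => by
      simp only [symbolLabels, List.append_nil, List.mem_cons, List.mem_append] at hl
      rcases hl with rfl | rfl | hl | hl
      · exact some_mem_inputLabels (by simp)
      · exact none_mem_inputLabels h
      · exact mem_inputLabels_of_mem_cellLabels hl
      · exact mem_inputLabels_of_mem_cellLabels hl) (symbolTable δ h m) hAs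
  obtain ⟨χ, hχ1, hχ2, hχ3⟩ := exists_isPlain_table.{u} (labelSize s n) A
    (nodup_inputLabels h) (ms := [some 0, none]) (fun l hl => by
      rcases List.mem_pair.1 hl with rfl | rfl
      · exact some_mem_inputLabels (by simp)
      · exact none_mem_inputLabels h) (stateTable δ) hAs
  refine ⟨Proof.tensorLList (nbool n A) (List.replicate (2 * h + 1) (nbool s A)) []
    (Proof.ofComponents _ (List.replicate (2 * h + 3) (nbool s A))
      (replFam (2 * h + 3) fun j => g ((j : ℤ) - (h + 1))) χ),
    ⟨_, ⟨_, χ, isPlain_replFam _ _ fun j => hg1 _, hχ1, .refl _⟩, .refl _⟩,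
    fun c hc => ?_, fun k _ v a b => ?_⟩
  · have H := EvalModel.E.tensorLList_ofComponents (M := cutModel α) (N := 2 * h + 1)
      (N' := 2 * h + 3) (X := nbool s A) (Y := nbool n A)
      (K := boolInputs (labelSize s n) A (configValues c) (inputLabels h))
      (q := boolProof A n c.state) (t := fun j => boolProof A s (c.window h j))
      (by rw [boolInputs, inputLabels, List.map_append, List.map_ofFn]; rfl)
      (fun j => hg2 ((j : ℤ) - (h + 1)) (configValues c)) (hχ2 (configValues c))
    simp only [symbolTable_configValues δ h hc, stateTable_configValues] at H
    rw [conf_cutModel, conf_cutModel] at H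
    -- The index types agree definitionally, as `2 * (h + 1) + 1` reduces to `2 * h + 3`; only the
    -- cast of `h + 1` to `ℤ` has to be simplified.
    have e : (c.step δ).window (h + 1) = fun j : Fin (2 * h + 3) =>
        (c.step δ).tape ((c.step δ).head + ((j : ℤ) - (h + 1))) := by
      ext j; simp [Config.window]
    rw [e]
    exact (closeAll_one (Δ₁ := []) (Δ₂ := []) (h := rfl)).symm.trans H.2
  · have H := EvalModel.E.tensorLList_ofComponents (M := vecModel v) (N := 2 * h + 1)
      (N' := 2 * h + 3) (X := nbool s A) (Y := nbool n A)
      (K := boolVecInputs (labelSize s n) A (labelCoeff a b) (inputLabels h))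
      (q := boolVec v A b) (t := fun j => boolVec v A (a ((j : ℤ) - h)))
      (by rw [boolVecInputs, inputLabels, List.map_append, List.map_ofFn]; rfl)
      (fun j => hg3 ((j : ℤ) - (h + 1)) k v (labelCoeff a b)) (hχ3 k v (labelCoeff a b))
    simp only [tableSum_symbolTable, tableSum_stateTable] at H
    rw [conf_vecModel, conf_vecModel] at H
    exact VecEval.den_eq H (.cons (A := confType s n A (2 * h + 1)) _ .nil)
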